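/- **Setting.** The Aztec diamond of size $n\ge 1$ is the bipartite graph with white vertices $w=(w_x,w_y)$, $w_x\in\{0,2,\dots,2n\}$, $w_y\in\{1,3,\dots,2n-1\}$, black vertices $b=(b_x,b_y)$, $b_x\in\{1,3,\dots,2n-1\}$, $b_y\in\{0,2,\dots,2n\}$, and an edge $wb$ whenever $|w_x-b_x|=|w_y-b_y|=1$; each edge is a diagonal of a unit square $[i,i+1]\times[j,j+1]$ with $0\le i,j\le 2n-1$ ("column $i$, row $j$"). Two positive edge weights $\nu,\tilde\nu$ are gauge equivalent if there is a function $\psi:\{\text{vertices}\}\to\mathbb{R}$ such that $\tilde\nu_{wb}=\psi(w)\,\nu_{wb}\,\psi(b)$ for every edge $wb$. *Biased $2\times2$-periodic weights.* For $a>0$, $b\in(0,1)$, the weights of the edges in row $j$ are, from left to right and repeated with period $4$: $(\frac1b,a,b,a)$ if $j\equiv0$, $(\frac ab,1,ab,1)$ if $j\equiv1$, $(b,a,\frac1b,a)$ if $j\equiv2$, $(ab,1,\frac ab,1)$ if $j\equiv3 \pmod 4$. *Genus-1 Fock weights.* Let $\tau\in i\mathbb{R}_+^*$ and let $\alpha,\beta,\gamma,\delta\in\mathbb{R}/\mathbb{Z}$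 be in cyclic order $\alpha<\gamma<\beta<\delta$, with $\beta-\alpha=\delta-\gamma=\frac12$ and $\gamma-\alpha=\delta-\beta=\rho\in(0,\frac12)$ in $\mathbb{R}/\mathbb{Z}$. Assign the angle $\alpha$ (resp. $\beta$) to the rows $j$ with $j$ even (resp. odd), and $\gamma$ (resp. $\delta$) to the columns $i$ with $i$ even (resp. odd). The discrete Abel map $\mathbf d$, with values in $\mathbb{R}/\mathbb{Z}$, is defined on the lattice points of $[0,2n]^2$ by $\mathbf d(0,0)=0$; it increases by $\gamma$ (resp. decreases by $\delta$) when crossing an even (resp. odd) column from left to right, and decreases by $\alpha$ (resp. increases by $\beta$) when crossing an even (resp. odd) row upwards. The Fock weight with parameter $t\in\mathbb{R}/\mathbb{Z}$ of an edge $wb$ in a column of angle $v$ and a row of angle $h$ is $$\left|\frac{\theta_1(\pi(v-h)\,|\,\tau)}{\pi\,\theta_1'(0)\;\theta_3(\pi(t+\mathbf d(f))\,|\,\tau)\;\theta_3(\pi(t+\mathbf d(f'))\,|\,\tau)}\right|,$$ where $f=(w_x,b_y)$ and $f'=(b_x,w_y)$ are the two faces adjacent to $wb$, and $\theta_1,\theta_3$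 are the Jacobi theta functions, $\theta_3(\pi z|\tau)=\sum_{m\in\mathbb{Z}}e^{i\pi(m^2\tau+2mz)}$ and $\theta_1(\pi z|\tau)=-\sum_{m\in\mathbb{Z}}e^{i\pi((m+\frac12)^2\tau+2(m+\frac12)(z+\frac12))}$. **Proposition.** Let $a>0$ and $b\in(0,1)$. There exist $\rho\in(0,\frac12)$ and $\tau\in i\mathbb{R}_+^*$ such that, for every $n\ge1$ and all $\alpha,\beta,\gamma,\delta$ as above with this $\rho$, the Fock weights with $t=\frac14$ and modular parameter $\tau$ on the Aztec diamond of size $n$ are gauge equivalent to the biased $2\times2$-periodic weights with parameters $a,b$. Moreover $\rho$ and $\tau$ (hence also the elliptic modulus) are uniquely determined by $a$ and $b$: if $\rho'\in(0,\frac12)$ and $\tau'\in i\mathbb{R}_+^*$ are such that, for some $n\ge2$ and some $\alpha,\beta,\gamma,\delta$ as above with $\gamma-\alpha=\rho'$, the Fock weights with $t=\frac14$ and modular parameter $\tau'$ are gauge equivalent to the biased weights, then $\rho'=\rho$ and $\tau'=\tau$. -/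

import Mathlib

namespace AztecFock

noncomputable section

/-! The Aztec diamond and gauge equivalence.

Vertices are given in integer coordinates, the bottom left boundary face being the origin. -/

/-- White vertices of the Aztec diamond of size `n`: first coordinate in `{0, 2, …, 2n}`,
second coordinate in `{1, 3, …, 2n - 1}`. -/
def whiteVertices (n : ℕ) : Set (ℕ × ℕ) :=
  {w | Even w.1 ∧ w.1 ≤ 2 * n ∧ Odd w.2 ∧ w.2 ≤ 2 * n}

/-- Black vertices of the Aztec diamond of size `n`: first coordinate in `{1, 3, …, 2n - 1}`,
second coordinate in `{0, 2, …, 2n}`. -/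
def blackVertices (n : ℕ) : Set (ℕ × ℕ) :=
  {b | Odd b.1 ∧ b.1 ≤ 2 * n ∧ Even b.2 ∧ b.2 ≤ 2 * n}

/-- `IsEdge n w b`: the white vertex `w` and the black vertex `b` of the Aztec diamond of size `n`
are neighbours, that is, they are diagonally opposite corners of a unit square. -/
def IsEdge (n : ℕ) (w b : ℕ × ℕ) : Prop :=
  w ∈ whiteVertices n ∧ b ∈ blackVertices n ∧
    (w.1 = b.1 + 1 ∨ b.1 = w.1 + 1) ∧ (w.2 = b.2 + 1 ∨ b.2 = w.2 + 1)

/-- Gauge equivalence of two weight functions on the edges (white vertex first) of the Aztec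
diamond of size `n`. Only the values of `ψ` on the vertices of the Aztec diamond matter. -/
def GaugeEquivalent (n : ℕ) (ν ν' : ℕ × ℕ → ℕ × ℕ → ℝ) : Prop :=
  ∃ ψ : ℕ × ℕ → ℝ, ∀ w b, IsEdge n w b → ν' w b = ψ w * ν w b * ψ b

/-- Column of the unit square whose diagonal is the edge `w b`: the square is
`[col, col + 1] × [row, row + 1]`. -/
def edgeCol (w b : ℕ × ℕ) : ℕ := min w.1 b.1

/-- Row of the unit square whose diagonal is the edge `w b`. -/
def edgeRow (w b : ℕ × ℕ) : ℕ := min w.2 b.2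

/-- The biased 2×2-periodic weights with parameters `a`, `b`. The rows of the array below are the
rows of edges of the Aztec diamond from bottom to top, the columns go from left to right, and the
pattern has period 4 in both directions. -/
def biasedWeight (a b : ℝ) (w v : ℕ × ℕ) : ℝ :=
  !![1 / b, a, b, a;
     a / b, 1, a * b, 1;
     b, a, 1 / b, a;
     a * b, 1, a / b, 1] (Fin.ofNat 4 (edgeRow w v)) (Fin.ofNat 4 (edgeCol w v))

/-! Theta functions and the prime form of the torus `ℂ / (ℤ + τ ℤ)`. -/

/-- The theta function in genus 1 with characteristic `(d', d'')`. -/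
def thetaChar (d' d'' : ℝ) (z τ : ℂ) : ℂ :=
  ∑' n : ℤ, Complex.exp (Real.pi * Complex.I *
    ((n + d') ^ 2 * τ + 2 * (n + d') * (z + d'')))

/-- The Jacobi theta function `θ₁(u | τ)`. -/
def theta1 (u τ : ℂ) : ℂ := -thetaChar (1 / 2) (1 / 2) (u / Real.pi) τ

/-- The Jacobi theta function `θ₃(u | τ)`; thus `θ₃(π z | τ)` is the Riemann theta function. -/
def theta3 (u τ : ℂ) : ℂ := jacobiTheta₂ (u / Real.pi) τ

/-- The prime form `E(u, v) = θ₁(π (v - u)) / (π θ₁'(0))`. -/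
def primeForm (τ u v : ℂ) : ℂ :=
  theta1 (Real.pi * (v - u)) τ / (Real.pi * deriv (fun z => theta1 z τ) 0)

/-! Fock's weights in genus 1.

The points of `A₀ = ℝ / ℤ` assigned to the train-tracks are given by lifts to `ℝ`: `α j`, `β j`
(horizontal train-tracks, left to right and right to left, from the bottom) and `γ j`, `δ j`
(vertical train-tracks, upwards and downwards, from the left), for `j = 1, …, n`. -/

/-- Angle of the horizontal train-track in the row `[j, j + 1]` of unit squares. -/
def rowAngle (α β : ℕ → ℝ) (j : ℕ) : ℝ := if Even j then α (j / 2 + 1) else β (j / 2 + 1)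

/-- Angle of the vertical train-track in the column `[i, i + 1]` of unit squares. -/
def colAngle (γ δ : ℕ → ℝ) (i : ℕ) : ℝ := if Even i then γ (i / 2 + 1) else δ (i / 2 + 1)

/-- The discrete Abel map at the vertex `f` of the diamond graph, with value `0` at the origin.
Following a horizontal, then a vertical path in the diamond graph: a step to the right across an
upward (downward) train-track either arrives at a black or leaves a white vertex (leaves a black or
arrives at a white vertex), so the angle is added (subtracted); a step upwards across a
left-to-right (right-to-left) train-track arrives at a white or leaves a black vertex (leaves a
white or arrives at a black vertex), so the angle is subtracted (added). -/
def abelMap (α β γ δ : ℕ → ℝ) (f : ℕ × ℕ) : ℝ :=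
  (∑ i ∈ Finset.range f.1, (-1) ^ i * colAngle γ δ i) +
    ∑ j ∈ Finset.range f.2, (-1) ^ (j + 1) * rowAngle α β j

/-- Fock's Kasteleyn coefficient in genus 1 at the edge `w b`. The faces adjacent to this edge are
`(w.1, b.2)` and `(b.1, w.2)`. The first argument of the prime form is the train-track that leaves
the unit square of the edge through the side joining `b` to the face on the left of the edge
directed from `w` to `b`: it is horizontal if col + row is even, and vertical otherwise. -/
def fockKasteleyn (τ : ℂ) (t : ℝ) (α β γ δ : ℕ → ℝ) (w b : ℕ × ℕ) : ℂ :=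
  (if Even (edgeCol w b + edgeRow w b) then
      primeForm τ (rowAngle α β (edgeRow w b)) (colAngle γ δ (edgeCol w b))
    else
      primeForm τ (colAngle γ δ (edgeCol w b)) (rowAngle α β (edgeRow w b))) /
    (theta3 (Real.pi * (t + abelMap α β γ δ (w.1, b.2))) τ *
      theta3 (Real.pi * (t + abelMap α β γ δ (b.1, w.2))) τ)

/-- Fock's weights: the moduli of the Kasteleyn coefficients. They do not depend on the choice of
the lifts of the angles. -/
def fockWeight (τ : ℂ) (t : ℝ) (α β γ δ : ℕ → ℝ) (w b : ℕ × ℕ) : ℝ :=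
  ‖fockKasteleyn τ t α β γ δ w b‖

/-- The four points occur in the strict cyclic order `p < q < r < s` on `ℝ / ℤ`. -/
def CyclicallyOrdered (p q r s : UnitAddCircle) : Prop := sbtw p q r ∧ sbtw r s p

/-- The condition on the four angles (given by lifts to `ℝ`): they satisfy `α < γ < β < δ`
cyclically on `ℝ / ℤ`, and `β - α = δ - γ = 1/2` and `γ - α = ρ` in `ℝ / ℤ`, with
`ρ ∈ (0, 1/2)`. -/
def BiasedAngles (ρ α β γ δ : ℝ) : Prop :=
  CyclicallyOrdered (α : UnitAddCircle) (γ : UnitAddCircle) (β : UnitAddCircle)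
      (δ : UnitAddCircle) ∧
    (β : UnitAddCircle) - (α : UnitAddCircle) = ((1 / 2 : ℝ) : UnitAddCircle) ∧
    (δ : UnitAddCircle) - (γ : UnitAddCircle) = ((1 / 2 : ℝ) : UnitAddCircle) ∧
    (γ : UnitAddCircle) - (α : UnitAddCircle) = (ρ : UnitAddCircle) ∧
    0 < ρ ∧ ρ < 1 / 2

end

end AztecFock

open AztecFock

namespace AztecFock

open Filter Topology

noncomputable section

/-! Write `τ = iy`, and `θ₁, θ₂, θ₃` at `π x`. Because opposite angles differ by `1/2` and `t =
1/4`, a Fock weight depends only on parities: its numerator is `θ₁(ρ)` or `θ₂(ρ)`, one adjacent face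
contributes the constant `θ₃(1/4)`, the other `θ₃(1/4 ± ρ)`. The biased weights factor in the same
pattern, up to a factor on white vertices. Hence the two equations `θ₂(ρ) = a θ₁(ρ)` and `θ₃(1/4 +
ρ) = b θ₃(1/4 - ρ)` suffice for gauge equivalence (`gaugeEquivalent_of_eq`), and for `n ≥ 2` the
alternating products around two faces make them necessary (`eq_of_gaugeEquivalent`).

To solve them, put `p = (a² - 1)/(a² + 1)` and `q = (1 - b²)/(1 + b²)`. Squaring and passing to `2y`
eliminates `ρ` and leaves `k² (1 - p² (1 - q²)) = q²`, with `k` the elliptic modulus at `2iy`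
(`sqrtModulus_pow_four_mul`). This fixes `k` in `(0, 1)`, hence `y`, since the modulus is a
bijection from `(0, ∞)` to `(0, 1)` (`sqrtModulus_injOn`, `exists_sqrtModulus_eq`). Then `ρ` is
determined because `θ₂/θ₁` is strictly decreasing on `(0, 1/2)`.

All properties of theta functions used here come from one product formula relating `y` to `2y`
(`realTheta_mul_realTheta`), together with the leading terms of the series as `y → ∞`. -/

/-- The general term of the theta series with characteristic `c` and modular parameter `i y`. -/
def thetaTerm (c y x : ℝ) (n : ℤ) : ℂ :=
  Complex.exp (((-(Real.pi * y * (n + c) ^ 2) : ℝ) : ℂ) +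
    ((2 * Real.pi * (n + c) * x : ℝ) : ℂ) * Complex.I)

/-- The theta series with characteristic `c` and modular parameter `i y`, in real form. -/
def realTheta (c y x : ℝ) : ℝ :=
  ∑' n : ℤ, Real.exp (-(Real.pi * y * (n + c) ^ 2)) * Real.cos (2 * Real.pi * (n + c) * x)

/-- The value `θ₃(π x | i y)`. -/
def realTheta3 (y x : ℝ) : ℝ := realTheta 0 y x

/-- The value `θ₂(π x | i y)`. -/
def realTheta2 (y x : ℝ) : ℝ := realTheta (1 / 2) y x

/-! ### Summability and reality of the theta series -/

lemma norm_thetaTerm (c y x : ℝ) (n : ℤ) :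
    ‖thetaTerm c y x n‖ = Real.exp (-(Real.pi * y * (n + c) ^ 2)) := by
  rw [thetaTerm, Complex.norm_exp, Complex.add_re, Complex.ofReal_re, Complex.re_ofReal_mul,
    Complex.I_re, mul_zero, add_zero]

lemma thetaTerm_eq (c y x : ℝ) (n : ℤ) :
    thetaTerm c y x n =
      ((Real.exp (-(Real.pi * y * (n + c) ^ 2)) * Real.cos (2 * Real.pi * (n + c) * x) : ℝ) : ℂ) +
      ((Real.exp (-(Real.pi * y * (n + c) ^ 2)) * Real.sin (2 * Real.pi * (n + c) * x) : ℝ) : ℂ) *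
        Complex.I := by
  rw [thetaTerm, Complex.exp_add, Complex.exp_mul_I, ← Complex.ofReal_cos, ← Complex.ofReal_sin,
    ← Complex.ofReal_exp]
  push_cast
  ring

/-- Expanding `(n + c)²` and bounding the cross term by `|c| |n|` reduces this to the standard bound
for the terms of `jacobiTheta₂`. -/
lemma summable_abs_pow_mul_gaussian (k : ℕ) (c : ℝ) {y : ℝ} (hy : 0 < y) :
    Summable fun n : ℤ => |(n : ℝ)| ^ k * Real.exp (-(Real.pi * y * (n + c) ^ 2)) := by
  have h := summable_pow_mul_jacobiTheta₂_term_bound (|c| * y) hy k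
  refine Summable.of_nonneg_of_le (fun n => by positivity) (fun n => ?_) h
  rw [Int.cast_abs]
  refine mul_le_mul_of_nonneg_left (Real.exp_le_exp.mpr ?_) (by positivity)
  have h1 : -(c * n) ≤ |c| * |(n : ℝ)| := by rw [← abs_mul]; exact neg_le_abs _
  have h2 : y * n ^ 2 - 2 * (|c| * y) * |(n : ℝ)| ≤ y * (n + c) ^ 2 := by
    nlinarith [mul_le_mul_of_nonneg_left h1 hy.le, mul_nonneg hy.le (sq_nonneg c)]
  nlinarith [mul_le_mul_of_nonneg_left h2 Real.pi_pos.le]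

lemma summable_gaussian (c : ℝ) {y : ℝ} (hy : 0 < y) :
    Summable fun n : ℤ => Real.exp (-(Real.pi * y * (n + c) ^ 2)) := by
  simpa using summable_abs_pow_mul_gaussian 0 c hy

lemma summable_abs_mul_gaussian (c : ℝ) {y : ℝ} (hy : 0 < y) :
    Summable fun n : ℤ => |2 * (n : ℝ) + 1| * Real.exp (-(Real.pi * y * (n + c) ^ 2)) := by
  have h := ((summable_abs_pow_mul_gaussian 1 c hy).mul_left 2).add (summable_gaussian c hy)
  refine Summable.of_nonneg_of_le (fun n => by positivity) (fun n => ?_) h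
  have h1 : |2 * (n : ℝ) + 1| ≤ 2 * |(n : ℝ)| + 1 := by
    refine (abs_add_le _ _).trans ?_
    rw [abs_mul]; simp
  nlinarith [mul_le_mul_of_nonneg_right h1 (Real.exp_pos (-(Real.pi * y * (n + c) ^ 2))).le]

lemma summable_norm_thetaTerm (c : ℝ) {y : ℝ} (hy : 0 < y) (x : ℝ) :
    Summable fun n : ℤ => ‖thetaTerm c y x n‖ := by
  simpa only [norm_thetaTerm] using summable_gaussian c hy

lemma summable_realTheta (c : ℝ) {y : ℝ} (hy : 0 < y) (x : ℝ) :
    Summable fun n : ℤ => Real.exp (-(Real.pi * y * (n + c) ^ 2)) *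
      Real.cos (2 * Real.pi * (n + c) * x) := by
  refine (summable_gaussian c hy).of_norm_bounded (fun n => ?_)
  rw [norm_mul, Real.norm_of_nonneg (Real.exp_pos _).le]
  exact mul_le_of_le_one_right (Real.exp_pos _).le (Real.abs_cos_le_one _)

lemma summable_realTheta_sin (c : ℝ) {y : ℝ} (hy : 0 < y) (x : ℝ) :
    Summable fun n : ℤ => Real.exp (-(Real.pi * y * (n + c) ^ 2)) *
      Real.sin (2 * Real.pi * (n + c) * x) := by
  refine (summable_gaussian c hy).of_norm_bounded (fun n => ?_)
  rw [norm_mul, Real.norm_of_nonneg (Real.exp_pos _).le]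
  exact mul_le_of_le_one_right (Real.exp_pos _).le (Real.abs_sin_le_one _)

/-- As `2c` is an integer, `n ↦ -2c - n` permutes `ℤ` and changes the sign of `n + c`, while the
sine is odd. -/
lemma tsum_sin_eq_zero {c : ℝ} {k : ℤ} (hc : 2 * c = k) (y x : ℝ) :
    ∑' n : ℤ, Real.exp (-(Real.pi * y * (n + c) ^ 2)) * Real.sin (2 * Real.pi * (n + c) * x) = 0 := by
  have h := (Equiv.subLeft (-k)).tsum_eq fun n : ℤ =>
    Real.exp (-(Real.pi * y * (n + c) ^ 2)) * Real.sin (2 * Real.pi * (n + c) * x)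
  have h2 : ∀ n : ℤ, Real.exp (-(Real.pi * y * (((Equiv.subLeft (-k)) n : ℤ) + c) ^ 2)) *
      Real.sin (2 * Real.pi * (((Equiv.subLeft (-k)) n : ℤ) + c) * x) =
      -(Real.exp (-(Real.pi * y * (n + c) ^ 2)) * Real.sin (2 * Real.pi * (n + c) * x)) := by
    intro n
    have h3 : (((Equiv.subLeft (-k)) n : ℤ) : ℝ) + c = -(n + c) := by
      rw [Equiv.subLeft_apply]
      push_cast
      linarith
    rw [h3, neg_sq, mul_neg, neg_mul, Real.sin_neg, mul_neg]
  rw [tsum_congr h2, tsum_neg] at h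
  linarith

lemma tsum_thetaTerm {c : ℝ} {k : ℤ} (hc : 2 * c = k) {y : ℝ} (hy : 0 < y) (x : ℝ) :
    ∑' n : ℤ, thetaTerm c y x n = (realTheta c y x : ℂ) := by
  simp_rw [thetaTerm_eq]
  rw [Summable.tsum_add, tsum_mul_right, ← Complex.ofReal_tsum, ← Complex.ofReal_tsum,
    tsum_sin_eq_zero hc, realTheta, Complex.ofReal_zero, zero_mul, add_zero]
  · exact_mod_cast summable_realTheta c hy x
  · exact (Complex.summable_ofReal.mpr (summable_realTheta_sin c hy x)).mul_right _

/-! ### Product formulas, symmetries and periods -/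

/-- The bijection of `ℤ²` with two copies of itself, according to the parity of the difference. -/
def parityEquiv : (ℤ × ℤ) ⊕ (ℤ × ℤ) ≃ ℤ × ℤ where
  toFun := Sum.elim (fun p => (p.1 + p.2, p.1 - p.2)) (fun p => (p.1 + p.2 + 1, p.1 - p.2))
  invFun p := if (p.1 - p.2) % 2 = 0 then Sum.inl ((p.1 + p.2) / 2, (p.1 - p.2) / 2)
    else Sum.inr ((p.1 + p.2 - 1) / 2, (p.1 - p.2 - 1) / 2)
  left_inv := by
    rintro (⟨j, k⟩ | ⟨j, k⟩)
    · refine (if_pos (show (j + k - (j - k)) % 2 = 0 by omega)).trans ?_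
      exact congrArg Sum.inl (Prod.ext (show (j + k + (j - k)) / 2 = j by omega)
        (show (j + k - (j - k)) / 2 = k by omega))
    · refine (if_neg (show ¬(j + k + 1 - (j - k)) % 2 = 0 by omega)).trans ?_
      exact congrArg Sum.inr (Prod.ext (show (j + k + 1 + (j - k) - 1) / 2 = j by omega)
        (show (j + k + 1 - (j - k) - 1) / 2 = k by omega))
  right_inv := by
    rintro ⟨m, n⟩
    by_cases h : (m - n) % 2 = 0
    · simp only [h, if_true, Sum.elim_inl]
      ext <;> dsimp only <;> omega
    · simp only [h, if_false, Sum.elim_inr]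
      ext <;> dsimp only <;> omega

/-- The parallelogram identity `(j + k + c)² + (j - k + c)² = 2 ((j + c)² + k²)` separates the
variables and doubles `y`. In the odd case both squares on the right are shifted by `1/2`. -/
lemma thetaTerm_mul_even (c y x z : ℝ) (j k : ℤ) :
    thetaTerm c y x (j + k) * thetaTerm c y z (j - k) =
      thetaTerm c (2 * y) (x + z) j * thetaTerm 0 (2 * y) (x - z) k := by
  simp only [thetaTerm, ← Complex.exp_add]
  congr 1
  push_cast
  ring

lemma thetaTerm_mul_odd (c y x z : ℝ) (j k : ℤ) :
    thetaTerm c y x (j + k + 1) * thetaTerm c y z (j - k) =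
      thetaTerm (c + 1 / 2) (2 * y) (x + z) j * thetaTerm (1 / 2) (2 * y) (x - z) k := by
  simp only [thetaTerm, ← Complex.exp_add]
  congr 1
  push_cast
  ring

/-- The product formula of theta series with the same characteristic. -/
lemma realTheta_mul_realTheta {c : ℝ} {k : ℤ} (hc : 2 * c = k) {y : ℝ} (hy : 0 < y) (x z : ℝ) :
    realTheta c y x * realTheta c y z =
      realTheta c (2 * y) (x + z) * realTheta 0 (2 * y) (x - z) +
      realTheta (c + 1 / 2) (2 * y) (x + z) * realTheta (1 / 2) (2 * y) (x - z) := by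
  have hy2 : 0 < 2 * y := by positivity
  have h0 : 2 * (0 : ℝ) = (0 : ℤ) := by simp
  have h1 : 2 * (1 / 2 : ℝ) = (1 : ℤ) := by norm_num
  have h2 : 2 * (c + 1 / 2) = ((k + 1 : ℤ) : ℝ) := by push_cast; linarith
  apply Complex.ofReal_injective
  push_cast
  rw [← tsum_thetaTerm hc hy x, ← tsum_thetaTerm hc hy z, ← tsum_thetaTerm hc hy2,
    ← tsum_thetaTerm h0 hy2]
  have e2 := tsum_thetaTerm h2 hy2 (x + z)
  have e1 := tsum_thetaTerm h1 hy2 (x - z)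
  rw [← e2, ← e1]
  rw [tsum_mul_tsum_of_summable_norm (summable_norm_thetaTerm _ hy _)
      (summable_norm_thetaTerm _ hy _),
    tsum_mul_tsum_of_summable_norm (summable_norm_thetaTerm _ hy2 _)
      (summable_norm_thetaTerm _ hy2 _),
    tsum_mul_tsum_of_summable_norm (summable_norm_thetaTerm _ hy2 _)
      (summable_norm_thetaTerm _ hy2 _), ← parityEquiv.tsum_eq]
  have s1 := (summable_mul_of_summable_norm (summable_norm_thetaTerm c hy2 (x + z))
      (summable_norm_thetaTerm 0 hy2 (x - z))).hasSum
  have s2 := (summable_mul_of_summable_norm (summable_norm_thetaTerm (c + 1 / 2) hy2 (x + z))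
      (summable_norm_thetaTerm (1 / 2) hy2 (x - z))).hasSum
  refine (HasSum.sum ?_ ?_).tsum_eq
  · convert s1 using 2 with p
    exact thetaTerm_mul_even c y x z p.1 p.2
  · convert s2 using 2 with p
    exact thetaTerm_mul_odd c y x z p.1 p.2

lemma realTheta_add_one_char (c y x : ℝ) : realTheta (c + 1) y x = realTheta c y x := by
  rw [realTheta, realTheta, ← (Equiv.addRight (1 : ℤ)).tsum_eq (fun n : ℤ =>
    Real.exp (-(Real.pi * y * (n + c) ^ 2)) * Real.cos (2 * Real.pi * (n + c) * x))]
  refine tsum_congr fun n => ?_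
  rw [Equiv.coe_addRight]
  push_cast
  congr 2 <;> ring_nf

lemma realTheta3_neg (y x : ℝ) : realTheta3 y (-x) = realTheta3 y x := by
  simp only [realTheta3, realTheta, mul_neg, Real.cos_neg]

lemma realTheta2_neg (y x : ℝ) : realTheta2 y (-x) = realTheta2 y x := by
  simp only [realTheta2, realTheta, mul_neg, Real.cos_neg]

lemma realTheta3_add_one (y x : ℝ) : realTheta3 y (x + 1) = realTheta3 y x := by
  refine tsum_congr fun n => ?_
  rw [show 2 * Real.pi * (n + 0) * (x + 1) = 2 * Real.pi * (n + 0) * x + n * (2 * Real.pi) by ring,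
    Real.cos_add_int_mul_two_pi]

lemma realTheta2_add_one (y x : ℝ) : realTheta2 y (x + 1) = -realTheta2 y x := by
  rw [realTheta2, realTheta2, realTheta, realTheta, ← tsum_neg]
  refine tsum_congr fun n => ?_
  rw [show 2 * Real.pi * (n + 1 / 2) * (x + 1) =
      2 * Real.pi * (n + 1 / 2) * x + Real.pi + n * (2 * Real.pi) by ring,
    Real.cos_add_int_mul_two_pi, Real.cos_add_pi, mul_neg]

lemma realTheta2_half (y : ℝ) : realTheta2 y (1 / 2) = 0 := by
  have h := realTheta2_add_one y (-(1 / 2))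
  rw [realTheta2_neg] at h
  norm_num at h ⊢
  linarith

lemma realTheta3_mul (y : ℝ) (hy : 0 < y) (x z : ℝ) :
    realTheta3 y x * realTheta3 y z =
      realTheta3 (2 * y) (x + z) * realTheta3 (2 * y) (x - z) +
      realTheta2 (2 * y) (x + z) * realTheta2 (2 * y) (x - z) := by
  have h := realTheta_mul_realTheta (c := 0) (k := 0) (by simp) hy x z
  rw [zero_add] at h
  exact h

lemma realTheta2_mul (y : ℝ) (hy : 0 < y) (x z : ℝ) :
    realTheta2 y x * realTheta2 y z =
      realTheta2 (2 * y) (x + z) * realTheta3 (2 * y) (x - z) +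
      realTheta3 (2 * y) (x + z) * realTheta2 (2 * y) (x - z) := by
  have h := realTheta_mul_realTheta (c := 1 / 2) (k := 1) (by norm_num) hy x z
  rw [show (1 / 2 + 1 / 2 : ℝ) = 0 + 1 by norm_num, realTheta_add_one_char] at h
  exact h

/-! ### Descent from large `y`, and leading terms of the series -/

/-- The product formulas express values at `y` through values at `2y`, so qualitative facts need to
be checked only where the leading terms dominate. -/
lemma forall_pos_of_eventually_of_double {P : ℝ → Prop} (h : ∀ᶠ y in atTop, P y)
    (hd : ∀ y, 0 < y → P (2 * y) → P y) {y : ℝ} (hy : 0 < y) : P y := by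
  have h1 : ∀ n : ℕ, ∀ y, 0 < y → P (2 ^ n * y) → P y := by
    intro n
    induction n with
    | zero => intro y _ h; simpa using h
    | succ n ih =>
      intro y hy h
      refine ih y hy (hd _ (by positivity) ?_)
      rwa [← mul_assoc, ← pow_succ']
  have h2 : Tendsto (fun n : ℕ => (2 : ℝ) ^ n * y) atTop atTop :=
    (tendsto_pow_atTop_atTop_of_one_lt one_lt_two).atTop_mul_const hy
  obtain ⟨n, hn⟩ := (h2.eventually h).exists
  exact h1 n y hy hn

/-- Used to keep a factor `cos (π x)` in every bound on `θ₂`, so that the bounds remain sharp near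
the zeros. In the induction the factor comes from `sin 2t = 2 sin t cos t`. -/
lemma abs_cos_odd_mul_le_nat (n : ℕ) (t : ℝ) :
    |Real.cos ((2 * n + 1) * t)| ≤ (2 * n + 1) * |Real.cos t| := by
  induction n with
  | zero => simp
  | succ n ih =>
    have h : Real.cos ((2 * ((n + 1 : ℕ) : ℝ) + 1) * t) =
        Real.cos ((2 * n + 1) * t) * Real.cos (2 * t) -
          Real.sin ((2 * n + 1) * t) * (2 * Real.sin t) * Real.cos t := by
      rw [mul_assoc, ← Real.sin_two_mul, ← Real.cos_add]
      push_cast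
      ring_nf
    have h1 : |Real.cos ((2 * n + 1) * t) * Real.cos (2 * t)| ≤ |Real.cos ((2 * n + 1) * t)| := by
      rw [abs_mul]
      exact mul_le_of_le_one_right (abs_nonneg _) (Real.abs_cos_le_one _)
    have h2 : |Real.sin ((2 * n + 1) * t) * (2 * Real.sin t) * Real.cos t| ≤ 2 * |Real.cos t| := by
      rw [abs_mul, abs_mul, abs_mul, abs_two]
      refine mul_le_mul_of_nonneg_right ?_ (abs_nonneg _)
      nlinarith [Real.abs_sin_le_one t, Real.abs_sin_le_one ((2 * n + 1) * t),
        abs_nonneg (Real.sin t), abs_nonneg (Real.sin ((2 * n + 1) * t))]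
    rw [h]
    refine (abs_sub _ _).trans ?_
    push_cast
    linarith

lemma abs_cos_odd_mul_le (n : ℤ) (t : ℝ) :
    |Real.cos ((2 * n + 1) * t)| ≤ |2 * (n : ℝ) + 1| * |Real.cos t| := by
  rcases le_or_gt 0 n with hn | hn
  · lift n to ℕ using hn
    have h := abs_cos_odd_mul_le_nat n t
    rwa [Int.cast_natCast, abs_of_nonneg (a := 2 * (n : ℝ) + 1) (by positivity)]
  · obtain ⟨m, rfl⟩ : ∃ m : ℕ, n = -(m + 1) := ⟨(-n - 1).toNat, by omega⟩
    have h := abs_cos_odd_mul_le_nat m t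
    have e : (2 * ((-(m + 1) : ℤ) : ℝ) + 1) = -(2 * m + 1) := by push_cast; ring
    rw [e, neg_mul, Real.cos_neg, abs_neg, abs_of_nonneg (a := 2 * (m : ℝ) + 1) (by positivity)]
    exact h

lemma abs_realTheta2_term_le (y x : ℝ) (n : ℤ) :
    ‖Real.exp (-(Real.pi * y * (n + 1 / 2) ^ 2)) * Real.cos (2 * Real.pi * (n + 1 / 2) * x)‖ ≤
      |2 * (n : ℝ) + 1| * Real.exp (-(Real.pi * y * (n + 1 / 2) ^ 2)) *
        |Real.cos (Real.pi * x)| := by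
  rw [norm_mul, Real.norm_of_nonneg (Real.exp_pos _).le, Real.norm_eq_abs,
    show 2 * Real.pi * (n + 1 / 2) * x = (2 * n + 1) * (Real.pi * x) by ring]
  calc _ ≤ Real.exp (-(Real.pi * y * (n + 1 / 2) ^ 2)) *
        (|2 * (n : ℝ) + 1| * |Real.cos (Real.pi * x)|) := by
        gcongr
        exact abs_cos_odd_mul_le n _
    _ = _ := by ring

lemma abs_realTheta2_le {y : ℝ} (hy : 0 < y) :
    ∃ C, ∀ x, |realTheta2 y x| ≤ C * |Real.cos (Real.pi * x)| :=
  ⟨_, fun x => tsum_of_norm_bounded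
    ((summable_abs_mul_gaussian (1 / 2) hy).hasSum.mul_right _) (abs_realTheta2_term_le y x)⟩

lemma abs_realTheta2_sub_le :
    ∃ C, ∀ y, 1 ≤ y → ∀ x,
      |realTheta2 y x - 2 * Real.exp (-(Real.pi * y / 4)) * Real.cos (Real.pi * x)| ≤
        C * Real.exp (-(9 * Real.pi / 4 * y)) * |Real.cos (Real.pi * x)| := by
  set s : Finset ℤ := {0, -1} with hs
  obtain ⟨A, hg⟩ := (summable_abs_mul_gaussian (1 / 2) one_pos).subtype ((s : Set ℤ)ᶜ)
  -- `A` is the tail at `y = 1`. Outside `n = 0, -1` one has `(n + 1/2)² ≥ 9/4`, so going from `1`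
  -- to `y` gains at least `exp (-(9π/4)(y - 1))`.
  refine ⟨A * Real.exp (9 * Real.pi / 4), fun y hy x => ?_⟩
  have h1 := (summable_realTheta (1 / 2) (one_pos.trans_le hy) x).sum_add_tsum_compl (s := s)
  have h2 : ∑ n ∈ s, Real.exp (-(Real.pi * y * (n + 1 / 2) ^ 2)) *
      Real.cos (2 * Real.pi * (n + 1 / 2) * x) =
      2 * Real.exp (-(Real.pi * y / 4)) * Real.cos (Real.pi * x) := by
    rw [hs, Finset.sum_pair (by norm_num)]
    push_cast
    rw [show 2 * Real.pi * (-1 + 1 / 2) * x = -(Real.pi * x) by ring, Real.cos_neg,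
      show 2 * Real.pi * (0 + 1 / 2) * x = Real.pi * x by ring]
    norm_num
    ring_nf
  rw [h2] at h1
  change _ = realTheta2 y x at h1
  rw [← h1, add_sub_cancel_left]
  have h3 := tsum_of_norm_bounded (f := fun n : ((s : Set ℤ)ᶜ : Set ℤ) =>
      Real.exp (-(Real.pi * y * ((n : ℤ) + 1 / 2) ^ 2)) *
        Real.cos (2 * Real.pi * ((n : ℤ) + 1 / 2) * x))
    (hg.mul_right (Real.exp (-(9 * Real.pi / 4 * (y - 1))) * |Real.cos (Real.pi * x)|)) ?_
  · refine h3.trans (le_of_eq ?_)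
    rw [show -(9 * Real.pi / 4 * (y - 1)) = 9 * Real.pi / 4 + -(9 * Real.pi / 4 * y) by ring,
      Real.exp_add]
    ring
  · rintro ⟨n, hn⟩
    refine (abs_realTheta2_term_le y x n).trans ?_
    simp only [Function.comp_apply]
    rw [← mul_assoc]
    refine mul_le_mul_of_nonneg_right ?_ (abs_nonneg _)
    rw [mul_assoc |2 * (n : ℝ) + 1|, ← Real.exp_add]
    refine mul_le_mul_of_nonneg_left (Real.exp_le_exp.mpr ?_) (abs_nonneg _)
    have h5 : 9 / 4 ≤ ((n : ℝ) + 1 / 2) ^ 2 := by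
      have h6 : n ≠ 0 ∧ n ≠ -1 := by simpa [hs] using hn
      have h7 : 2 ≤ n * (n + 1) := by
        rcases lt_or_ge n 0 with h | h
        · nlinarith [show n ≤ -2 by omega]
        · nlinarith [show 1 ≤ n by omega]
      have h8 : (2 : ℝ) ≤ n * (n + 1) := by exact_mod_cast h7
      nlinarith
    nlinarith [mul_nonneg (mul_nonneg Real.pi_pos.le (sub_nonneg.mpr hy)) (sub_nonneg.mpr h5)]

lemma abs_realTheta3_sub_one_le :
    ∃ C, ∀ y, 1 ≤ y → ∀ x, |realTheta3 y x - 1| ≤ C * Real.exp (-(Real.pi * y)) := by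
  set s : Finset ℤ := {0} with hs
  obtain ⟨A, hg⟩ := (summable_gaussian 0 one_pos).subtype ((s : Set ℤ)ᶜ)
  refine ⟨A * Real.exp Real.pi, fun y hy x => ?_⟩
  have h1 := (summable_realTheta 0 (one_pos.trans_le hy) x).sum_add_tsum_compl (s := s)
  have h2 : ∑ n ∈ s, Real.exp (-(Real.pi * y * (n + 0) ^ 2)) *
      Real.cos (2 * Real.pi * (n + 0) * x) = 1 := by
    simp [hs]
  rw [h2] at h1
  change _ = realTheta3 y x at h1
  rw [← h1, add_sub_cancel_left]
  have h3 := tsum_of_norm_bounded (f := fun n : ((s : Set ℤ)ᶜ : Set ℤ) =>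
      Real.exp (-(Real.pi * y * ((n : ℤ) + 0) ^ 2)) *
        Real.cos (2 * Real.pi * ((n : ℤ) + 0) * x))
    (hg.mul_right (Real.exp (-(Real.pi * (y - 1))))) ?_
  · refine h3.trans (le_of_eq ?_)
    rw [show -(Real.pi * (y - 1)) = Real.pi + -(Real.pi * y) by ring, Real.exp_add]
    ring
  · rintro ⟨n, hn⟩
    rw [norm_mul, Real.norm_of_nonneg (Real.exp_pos _).le]
    refine (mul_le_of_le_one_right (Real.exp_pos _).le (Real.abs_cos_le_one _)).trans ?_
    simp only [Function.comp_apply]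
    rw [← Real.exp_add]
    refine Real.exp_le_exp.mpr ?_
    have h5 : 1 ≤ ((n : ℝ) + 0) ^ 2 := by
      have h6 : n ≠ 0 := by simpa [hs] using hn
      have h7 : 1 ≤ n ^ 2 := Int.one_le_abs h6 |>.trans (by
        rw [← sq_abs]; nlinarith [Int.one_le_abs h6])
      rw [add_zero]
      exact_mod_cast h7
    nlinarith [mul_nonneg (mul_nonneg Real.pi_pos.le (sub_nonneg.mpr hy)) (sub_nonneg.mpr h5)]

lemma tendsto_exp_neg_mul_atTop {c : ℝ} (hc : 0 < c) :
    Tendsto (fun y : ℝ => Real.exp (-(c * y))) atTop (𝓝 0) :=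
  Real.tendsto_exp_neg_atTop_nhds_zero.comp (tendsto_id.const_mul_atTop hc)

lemma eventually_abs_realTheta3_sub_one_le :
    ∀ᶠ y in atTop, ∀ x, |realTheta3 y x - 1| ≤ 1 / 2 := by
  obtain ⟨C, hC⟩ := abs_realTheta3_sub_one_le
  have h : Tendsto (fun y : ℝ => C * Real.exp (-(Real.pi * y))) atTop (𝓝 0) := by
    simpa using (tendsto_exp_neg_mul_atTop Real.pi_pos).const_mul C
  filter_upwards [eventually_ge_atTop 1,
    h.eventually (gt_mem_nhds (show (0 : ℝ) < 1 / 2 by norm_num))] with y hy h x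
  exact (hC y hy x).trans h.le

lemma eventually_abs_realTheta2_sub_le :
    ∀ᶠ y in atTop, ∀ x,
      |realTheta2 y x - 2 * Real.exp (-(Real.pi * y / 4)) * Real.cos (Real.pi * x)| ≤
        Real.exp (-(Real.pi * y / 4)) * |Real.cos (Real.pi * x)| := by
  obtain ⟨C, hC⟩ := abs_realTheta2_sub_le
  have h : Tendsto (fun y : ℝ => C * Real.exp (-(2 * Real.pi * y))) atTop (𝓝 0) := by
    simpa using (tendsto_exp_neg_mul_atTop Real.two_pi_pos).const_mul C
  filter_upwards [eventually_ge_atTop 1, h.eventually (gt_mem_nhds one_pos)] with y hy h x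
  refine (hC y hy x).trans (mul_le_mul_of_nonneg_right ?_ (abs_nonneg _))
  rw [show -(9 * Real.pi / 4 * y) = -(2 * Real.pi * y) + -(Real.pi * y / 4) by ring, Real.exp_add,
    ← mul_assoc]
  exact mul_le_of_le_one_left (Real.exp_pos _).le h.le

/-! ### Signs and zeros on the real line -/

/-- One of the two terms of the product formula vanishes since `θ₂` is zero at `1/2`. The single
product left lets non-vanishing descend from `2y` to `y`. -/
lemma realTheta3_mul_add_half {y : ℝ} (hy : 0 < y) (x : ℝ) :
    realTheta3 y x * realTheta3 y (x + 1 / 2) =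
      realTheta3 (2 * y) (2 * x + 1 / 2) * realTheta3 (2 * y) (1 / 2) := by
  rw [realTheta3_mul y hy, show x - (x + 1 / 2) = -(1 / 2) by ring, realTheta3_neg,
    realTheta2_neg, realTheta2_half, mul_zero, add_zero]
  ring_nf

lemma realTheta2_mul_add_half {y : ℝ} (hy : 0 < y) (x : ℝ) :
    realTheta2 y x * realTheta2 y (x + 1 / 2) =
      realTheta2 (2 * y) (2 * x + 1 / 2) * realTheta3 (2 * y) (1 / 2) := by
  rw [realTheta2_mul y hy, show x - (x + 1 / 2) = -(1 / 2) by ring, realTheta3_neg,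
    realTheta2_neg, realTheta2_half, mul_zero, add_zero]
  ring_nf

lemma realTheta3_ne_zero {y : ℝ} (hy : 0 < y) : ∀ x, realTheta3 y x ≠ 0 := by
  refine forall_pos_of_eventually_of_double (P := fun y => ∀ x, realTheta3 y x ≠ 0) ?_ ?_ hy
  · filter_upwards [eventually_abs_realTheta3_sub_one_le] with y h x h0
    have := h x
    rw [h0] at this
    norm_num at this
  · intro y hy h x h0
    have := realTheta3_mul_add_half hy x
    rw [h0, zero_mul] at this
    exact mul_ne_zero (h _) (h _) this.symm

lemma realTheta_zero_pos (c : ℝ) {y : ℝ} (hy : 0 < y) : 0 < realTheta c y 0 := by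
  refine (summable_realTheta c hy 0).tsum_pos (fun n => ?_) 0 ?_
  · rw [mul_zero, Real.cos_zero]; positivity
  · rw [mul_zero, Real.cos_zero]; positivity

lemma realTheta3_zero_pos {y : ℝ} (hy : 0 < y) : 0 < realTheta3 y 0 := realTheta_zero_pos 0 hy

lemma realTheta2_zero_pos {y : ℝ} (hy : 0 < y) : 0 < realTheta2 y 0 := realTheta_zero_pos _ hy

lemma continuous_realTheta (c : ℝ) {y : ℝ} (hy : 0 < y) : Continuous (realTheta c y) := by
  refine continuous_tsum (fun n => by fun_prop) (summable_gaussian c hy) fun n x => ?_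
  rw [norm_mul, Real.norm_of_nonneg (Real.exp_pos _).le]
  exact mul_le_of_le_one_right (Real.exp_pos _).le (Real.abs_cos_le_one _)

lemma continuous_realTheta3 {y : ℝ} (hy : 0 < y) : Continuous (realTheta3 y) :=
  continuous_realTheta 0 hy

lemma continuous_realTheta2 {y : ℝ} (hy : 0 < y) : Continuous (realTheta2 y) :=
  continuous_realTheta _ hy

lemma continuousOn_realTheta_zero (c : ℝ) :
    ContinuousOn (fun y => realTheta c y 0) (Set.Ioi 0) := by
  intro y hy
  have hy' : 0 < y / 2 := half_pos hy
  have h : ContinuousOn (fun y => realTheta c y 0) (Set.Ici (y / 2)) := by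
    refine continuousOn_tsum (fun n => by fun_prop) (summable_gaussian c hy') fun n z hz => ?_
    rw [norm_mul, Real.norm_of_nonneg (Real.exp_pos _).le, mul_zero, Real.cos_zero, norm_one,
      mul_one]
    refine Real.exp_le_exp.mpr (neg_le_neg ?_)
    have : y / 2 ≤ z := hz
    gcongr
  exact (h.continuousAt (Ici_mem_nhds (half_lt_self hy))).continuousWithinAt

lemma pos_of_continuousOn_of_ne_zero {f : ℝ → ℝ} {s : Set ℝ} (hs : IsPreconnected s)
    (hf : ContinuousOn f s) (h0 : ∀ x ∈ s, f x ≠ 0) {a : ℝ} (ha : a ∈ s) (hfa : 0 < f a) {x : ℝ}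
    (hx : x ∈ s) : 0 < f x := by
  by_contra! h
  obtain ⟨z, hz, hz0⟩ := hs.intermediate_value hx ha hf ⟨h, hfa.le⟩
  exact h0 z hz hz0

lemma realTheta3_pos {y : ℝ} (hy : 0 < y) (x : ℝ) : 0 < realTheta3 y x :=
  pos_of_continuousOn_of_ne_zero isPreconnected_univ (continuous_realTheta3 hy).continuousOn
    (fun x _ => realTheta3_ne_zero hy x) (Set.mem_univ 0) (realTheta3_zero_pos hy) (Set.mem_univ x)

lemma abs_realTheta2_intCast (y : ℝ) (n : ℤ) : |realTheta2 y n| = |realTheta2 y 0| := by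
  have h : Function.Periodic (fun x => |realTheta2 y x|) 1 := fun x => by
    simp only [realTheta2_add_one, abs_neg]
  simpa using h.int_mul_eq n

/-- The zeros of `θ₂` on the real line are the zeros of the cosine, and they are simple. -/
lemma exists_mul_abs_cos_le_abs_realTheta2 {y : ℝ} (hy : 0 < y) :
    ∃ c > 0, ∀ x, c * |Real.cos (Real.pi * x)| ≤ |realTheta2 y x| := by
  refine forall_pos_of_eventually_of_double
    (P := fun y => ∃ c > 0, ∀ x, c * |Real.cos (Real.pi * x)| ≤ |realTheta2 y x|) ?_ ?_ hy
  · filter_upwards [eventually_abs_realTheta2_sub_le] with y h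
    refine ⟨Real.exp (-(Real.pi * y / 4)), Real.exp_pos _, fun x => ?_⟩
    have h1 := abs_sub_abs_le_abs_sub
      (2 * Real.exp (-(Real.pi * y / 4)) * Real.cos (Real.pi * x)) (realTheta2 y x)
    rw [abs_sub_comm, abs_mul, abs_mul, abs_two, abs_of_pos (Real.exp_pos _)] at h1
    linarith [h x]
  · rintro y hy ⟨c, hc, h⟩
    obtain ⟨M, hM⟩ := abs_realTheta2_le hy
    have h0 := realTheta2_zero_pos hy
    have hM0 : 0 < M := by
      have := hM 0
      rw [mul_zero, Real.cos_zero, abs_one, mul_one, abs_of_pos h0] at this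
      linarith
    have hD := realTheta3_pos (show 0 < 2 * y by positivity) (1 / 2)
    set D := realTheta3 (2 * y) (1 / 2)
    -- At integers `|θ₂|` equals `θ₂(0)`. Elsewhere, in `θ₂(x) θ₂(x + 1/2) = θ₂(2x + 1/2) D` (last
    -- factors at `2y`), the right side is at least `2cD |sin (π x) cos (π x)|` in modulus and
    -- `|θ₂(x + 1/2)| ≤ M |sin (π x)|`; the sine cancels.
    refine ⟨min (realTheta2 y 0) (2 * D * c / M), by positivity, fun x => ?_⟩
    by_cases hs : Real.sin (Real.pi * x) = 0
    · obtain ⟨n, hn⟩ := Real.sin_eq_zero_iff.mp hs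
      obtain rfl : (n : ℝ) = x := by
        rw [mul_comm] at hn
        exact mul_left_cancel₀ Real.pi_ne_zero hn
      rw [abs_realTheta2_intCast, abs_of_pos h0]
      calc _ ≤ realTheta2 y 0 * 1 :=
            mul_le_mul (min_le_left _ _) (Real.abs_cos_le_one _) (abs_nonneg _) h0.le
        _ = _ := mul_one _
    · refine (mul_le_mul_of_nonneg_right (min_le_right _ _) (abs_nonneg _)).trans ?_
      rw [div_mul_eq_mul_div, div_le_iff₀ hM0]
      refine le_of_mul_le_mul_right ?_ (abs_pos.mpr hs)
      have h1 := congrArg abs (realTheta2_mul_add_half hy x)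
      rw [abs_mul, abs_mul, abs_of_pos hD] at h1
      have h2 := h (2 * x + 1 / 2)
      rw [show Real.pi * (2 * x + 1 / 2) = 2 * (Real.pi * x) + Real.pi / 2 by ring,
        Real.cos_add_pi_div_two, abs_neg, Real.sin_two_mul, abs_mul, abs_mul, abs_two] at h2
      have h3 := hM (x + 1 / 2)
      rw [show Real.pi * (x + 1 / 2) = Real.pi * x + Real.pi / 2 by ring,
        Real.cos_add_pi_div_two, abs_neg] at h3
      have h4 := mul_le_mul_of_nonneg_right h2 hD.le
      have h5 := mul_le_mul_of_nonneg_left h3 (abs_nonneg (realTheta2 y x))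
      linarith

lemma realTheta2_pos {y x : ℝ} (hy : 0 < y) (hx : x ∈ Set.Ioo (-(1 / 2) : ℝ) (1 / 2)) :
    0 < realTheta2 y x := by
  refine pos_of_continuousOn_of_ne_zero isPreconnected_Ioo (continuous_realTheta2 hy).continuousOn
    (fun z hz h0 => ?_) (a := 0) (by norm_num) (realTheta2_zero_pos hy) hx
  obtain ⟨c, hc, h⟩ := exists_mul_abs_cos_le_abs_realTheta2 hy
  have h1 : 0 < Real.cos (Real.pi * z) := by
    refine Real.cos_pos_of_mem_Ioo ⟨?_, ?_⟩ <;> nlinarith [hz.1, hz.2, Real.pi_pos]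
  have h2 := h z
  rw [h0, abs_zero, abs_of_pos h1] at h2
  nlinarith

/-! ### Reflections and quadratic identities -/

lemma realTheta3_half_add (y x : ℝ) : realTheta3 y (1 / 2 + x) = realTheta3 y (1 / 2 - x) := by
  rw [← realTheta3_neg y (1 / 2 + x), ← realTheta3_add_one y (-(1 / 2 + x))]
  ring_nf

lemma realTheta2_half_add (y x : ℝ) : realTheta2 y (1 / 2 + x) = -realTheta2 y (1 / 2 - x) := by
  rw [show 1 / 2 - x = -(1 / 2 + x) + 1 by ring, realTheta2_add_one, realTheta2_neg, neg_neg]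

lemma realTheta3_one_sub (y x : ℝ) : realTheta3 y (1 - x) = realTheta3 y x := by
  rw [← realTheta3_neg y x, ← realTheta3_add_one y (-x)]
  ring_nf

lemma realTheta2_one_sub (y x : ℝ) : realTheta2 y (1 - x) = -realTheta2 y x := by
  rw [← realTheta2_neg y x, ← realTheta2_add_one y (-x)]
  ring_nf

lemma realTheta3_sq {y : ℝ} (hy : 0 < y) (x : ℝ) :
    realTheta3 y x ^ 2 = realTheta3 (2 * y) (2 * x) * realTheta3 (2 * y) 0 +
      realTheta2 (2 * y) (2 * x) * realTheta2 (2 * y) 0 := by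
  rw [sq, realTheta3_mul y hy, sub_self, two_mul x]

lemma realTheta2_sq {y : ℝ} (hy : 0 < y) (x : ℝ) :
    realTheta2 y x ^ 2 = realTheta2 (2 * y) (2 * x) * realTheta3 (2 * y) 0 +
      realTheta3 (2 * y) (2 * x) * realTheta2 (2 * y) 0 := by
  rw [sq, realTheta2_mul y hy, sub_self, two_mul x]

lemma realTheta3_half_sub_sq {y : ℝ} (hy : 0 < y) (x : ℝ) :
    realTheta3 y (1 / 2 - x) ^ 2 = realTheta3 (2 * y) (2 * x) * realTheta3 (2 * y) 0 -
      realTheta2 (2 * y) (2 * x) * realTheta2 (2 * y) 0 := by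
  rw [realTheta3_sq hy, show 2 * (1 / 2 - x) = 1 - 2 * x by ring, realTheta3_one_sub,
    realTheta2_one_sub]
  ring

lemma realTheta2_half_sub_sq {y : ℝ} (hy : 0 < y) (x : ℝ) :
    realTheta2 y (1 / 2 - x) ^ 2 = realTheta3 (2 * y) (2 * x) * realTheta2 (2 * y) 0 -
      realTheta2 (2 * y) (2 * x) * realTheta3 (2 * y) 0 := by
  rw [realTheta2_sq hy, show 2 * (1 / 2 - x) = 1 - 2 * x by ring, realTheta3_one_sub,
    realTheta2_one_sub]
  ring

/-- `θ₂² θ₄(0)² = θ₄² θ₂(0)² - θ₁² θ₃(0)²`. -/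
lemma realTheta2_sq_mul_sq {y : ℝ} (hy : 0 < y) (x : ℝ) :
    realTheta2 y x ^ 2 * realTheta3 y (1 / 2) ^ 2 =
      realTheta3 y (1 / 2 - x) ^ 2 * realTheta2 y 0 ^ 2 -
        realTheta2 y (1 / 2 - x) ^ 2 * realTheta3 y 0 ^ 2 := by
  have h := realTheta3_half_sub_sq hy 0
  rw [sub_zero, mul_zero] at h
  rw [h, realTheta3_half_sub_sq hy, realTheta2_half_sub_sq hy, realTheta2_sq hy, realTheta2_sq hy 0,
    realTheta3_sq hy 0, mul_zero]
  ring

/-- `θ₃² θ₄(0)² = θ₄² θ₃(0)² - θ₁² θ₂(0)²`. -/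
lemma realTheta3_sq_mul_sq {y : ℝ} (hy : 0 < y) (x : ℝ) :
    realTheta3 y x ^ 2 * realTheta3 y (1 / 2) ^ 2 =
      realTheta3 y (1 / 2 - x) ^ 2 * realTheta3 y 0 ^ 2 -
        realTheta2 y (1 / 2 - x) ^ 2 * realTheta2 y 0 ^ 2 := by
  have h := realTheta3_half_sub_sq hy 0
  rw [sub_zero, mul_zero] at h
  rw [h, realTheta3_half_sub_sq hy, realTheta2_half_sub_sq hy, realTheta3_sq hy, realTheta2_sq hy 0,
    realTheta3_sq hy 0, mul_zero]
  ring

/-! ### The elliptic modulus as a function of `y` -/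

/-- The square root `θ₂(0 | i y) / θ₃(0 | i y)` of the elliptic modulus. -/
def sqrtModulus (y : ℝ) : ℝ := realTheta2 y 0 / realTheta3 y 0

lemma sqrtModulus_pos {y : ℝ} (hy : 0 < y) : 0 < sqrtModulus y :=
  div_pos (realTheta2_zero_pos hy) (realTheta3_zero_pos hy)

/-- Landen's transformation of the modulus. -/
lemma sqrtModulus_sq {y : ℝ} (hy : 0 < y) :
    sqrtModulus y ^ 2 * (1 + sqrtModulus (2 * y) ^ 2) = 2 * sqrtModulus (2 * y) := by
  have hy2 : 0 < 2 * y := by positivity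
  have h3 := (realTheta3_zero_pos hy).ne'
  have h3' := (realTheta3_zero_pos hy2).ne'
  have e2 := realTheta2_sq hy 0
  have e3 := realTheta3_sq hy 0
  rw [mul_zero] at e2 e3
  have h4 : realTheta3 (2 * y) 0 ^ 2 + realTheta2 (2 * y) 0 ^ 2 ≠ 0 := by positivity
  rw [sqrtModulus, sqrtModulus, div_pow, e2, e3, ← sq, ← sq]
  field_simp
  ring

lemma eventually_sqrtModulus_mem :
    ∀ᶠ y in atTop, 2 / 3 * Real.exp (-(Real.pi * y / 4)) ≤ sqrtModulus y ∧
      sqrtModulus y ≤ 6 * Real.exp (-(Real.pi * y / 4)) := by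
  filter_upwards [eventually_abs_realTheta2_sub_le, eventually_abs_realTheta3_sub_one_le,
    eventually_gt_atTop 0] with y h2 h3 hy
  have h2' := h2 0
  rw [mul_zero, Real.cos_zero, abs_one, mul_one, mul_one, abs_le] at h2'
  have h3' := abs_le.mp (h3 0)
  have hp := realTheta3_zero_pos hy
  have hE := Real.exp_pos (-(Real.pi * y / 4))
  -- With `E = exp (-π y / 4)`, `θ₂(0)` lies in `[E, 3E]` and `θ₃(0)` in `[1/2, 3/2]`, whence `2/3`
  -- and `6`.
  rw [sqrtModulus, le_div_iff₀ hp, div_le_iff₀ hp]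
  constructor <;> nlinarith [h2'.1, h2'.2, h3'.1, h3'.2]

lemma eventually_sqrtModulus_lt {c : ℝ} (hc : 0 < c) : ∀ᶠ y in atTop, sqrtModulus y < c := by
  have h : Tendsto (fun y : ℝ => 6 * Real.exp (-(Real.pi / 4 * y))) atTop (𝓝 0) := by
    simpa using (tendsto_exp_neg_mul_atTop (c := Real.pi / 4) (by positivity)).const_mul 6
  filter_upwards [eventually_sqrtModulus_mem, h.eventually (gt_mem_nhds hc)] with y h1 h2
  rw [show Real.pi / 4 * y = Real.pi * y / 4 by ring] at h2
  exact h1.2.trans_lt h2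

/-- Descent: for `s ≠ 1`, `2s < 1 + s²`, so Landen's transformation keeps the modulus below `1`. -/
lemma sqrtModulus_lt_one {y : ℝ} (hy : 0 < y) : sqrtModulus y < 1 := by
  refine forall_pos_of_eventually_of_double (P := fun y => sqrtModulus y < 1)
    (eventually_sqrtModulus_lt one_pos) (fun y hy h => ?_) hy
  have h1 := sqrtModulus_sq hy
  have h2 := sqrtModulus_pos hy
  by_contra! h3
  have h4 : 1 ≤ sqrtModulus y ^ 2 := one_le_pow₀ h3
  nlinarith [mul_pos (sub_pos.mpr h) (sub_pos.mpr h),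
    mul_le_mul_of_nonneg_right h4 (by positivity : 0 ≤ 1 + sqrtModulus (2 * y) ^ 2)]

/-- In Landen's transformation, `s ↦ 2s / (1 + s²)` is injective on `(0, 1)`. -/
lemma sqrtModulus_double_eq {y z : ℝ} (hy : 0 < y) (hz : 0 < z)
    (h : sqrtModulus y = sqrtModulus z) : sqrtModulus (2 * y) = sqrtModulus (2 * z) := by
  have hy2 : 0 < 2 * y := by positivity
  have hz2 : 0 < 2 * z := by positivity
  have e1 := sqrtModulus_sq hy
  have e2 := sqrtModulus_sq hz
  rw [h] at e1
  have l1 := sqrtModulus_lt_one hy2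
  have l2 := sqrtModulus_lt_one hz2
  have p1 := sqrtModulus_pos hy2
  have p2 := sqrtModulus_pos hz2
  have h3 : (sqrtModulus (2 * y) - sqrtModulus (2 * z)) *
      (1 - sqrtModulus (2 * y) * sqrtModulus (2 * z)) = 0 := by
    linear_combination -((1 + sqrtModulus (2 * z) ^ 2) / 2) * e1 +
      ((1 + sqrtModulus (2 * y) ^ 2) / 2) * e2
  have h4 : 1 - sqrtModulus (2 * y) * sqrtModulus (2 * z) ≠ 0 := by nlinarith
  exact sub_eq_zero.mp ((mul_eq_zero.mp h3).resolve_right h4)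

/-- Equality would propagate to `2ⁿ y` and `2ⁿ z` for all `n`, but there the leading exponentials
have a ratio tending to `0`. -/
lemma sqrtModulus_ne_of_lt {y z : ℝ} (hy : 0 < y) (hyz : y < z) :
    sqrtModulus y ≠ sqrtModulus z := by
  intro h
  have hz := hy.trans hyz
  have h1 : ∀ n : ℕ, sqrtModulus (2 ^ n * y) = sqrtModulus (2 ^ n * z) := by
    intro n
    induction n with
    | zero => simpa using h
    | succ n ih =>
      rw [pow_succ', mul_assoc, mul_assoc]
      exact sqrtModulus_double_eq (by positivity) (by positivity) ih
  have hp := tendsto_pow_atTop_atTop_of_one_lt (one_lt_two : (1 : ℝ) < 2)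
  have ey := (hp.atTop_mul_const hy).eventually eventually_sqrtModulus_mem
  have ez := (hp.atTop_mul_const hz).eventually eventually_sqrtModulus_mem
  -- The threshold `1/9` is the ratio of the constants `2/3` and `6` in
  -- `eventually_sqrtModulus_mem`.
  have ed := ((hp.atTop_mul_const (sub_pos.mpr hyz)).eventually
    ((tendsto_exp_neg_mul_atTop (c := Real.pi / 4) (by positivity)).eventually
      (gt_mem_nhds (show (0 : ℝ) < 1 / 9 by norm_num))))
  obtain ⟨n, ⟨h2, -⟩, ⟨-, h3⟩, h4⟩ := (ey.and (ez.and ed)).exists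
  rw [h1 n] at h2
  have h5 : Real.exp (-(Real.pi * (2 ^ n * z) / 4)) =
      Real.exp (-(Real.pi / 4 * (2 ^ n * (z - y)))) * Real.exp (-(Real.pi * (2 ^ n * y) / 4)) := by
    rw [← Real.exp_add]
    ring_nf
  rw [h5] at h3
  nlinarith [Real.exp_pos (-(Real.pi * (2 ^ n * y) / 4))]

lemma sqrtModulus_injOn : Set.InjOn sqrtModulus (Set.Ioi 0) := by
  intro y hy z hz h
  by_contra hne
  rcases lt_or_gt_of_ne hne with hlt | hlt
  · exact sqrtModulus_ne_of_lt hy hlt h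
  · exact sqrtModulus_ne_of_lt hz hlt h.symm

lemma sqrtModulus_le_sq {y : ℝ} (hy : 0 < y) : sqrtModulus (2 * y) ≤ sqrtModulus y ^ 2 := by
  have hy2 : 0 < 2 * y := by positivity
  have h := sqrtModulus_sq hy
  have l := sqrtModulus_lt_one hy2
  have p := sqrtModulus_pos hy2
  by_contra! h1
  nlinarith [mul_pos p p]

/-- If `c` bounded the function, iterating `sqrtModulus_le_sq` from `2⁻ⁿ` up to `1` would give
`sqrtModulus 1 ≤ c ^ 2ⁿ` for all `n`, contradicting positivity. -/
lemma exists_lt_sqrtModulus {c : ℝ} (hc0 : 0 < c) (hc : c < 1) : ∃ y > 0, c < sqrtModulus y := by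
  by_contra! h
  have h1 : ∀ n : ℕ, ∀ y > 0, sqrtModulus (2 ^ n * y) ≤ sqrtModulus y ^ 2 ^ n := by
    intro n
    induction n with
    | zero => intro y _; simp
    | succ n ih =>
      intro y hy
      have h1 := ih (2 * y) (by positivity)
      have h2 := pow_le_pow_left₀ (sqrtModulus_pos (by positivity)).le (sqrtModulus_le_sq hy) (2 ^ n)
      rw [← pow_mul, ← pow_succ'] at h2
      rw [← mul_assoc, ← pow_succ] at h1
      exact h1.trans h2
  obtain ⟨n, hn⟩ := (((tendsto_pow_atTop_nhds_zero_of_lt_one hc0.le hc).comp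
    (tendsto_pow_atTop_atTop_of_one_lt (one_lt_two : 1 < 2))).eventually
      (gt_mem_nhds (sqrtModulus_pos one_pos))).exists
  have h2 := h1 n (1 / 2 ^ n) (by positivity)
  rw [mul_one_div_cancel (by positivity)] at h2
  have h3 := pow_le_pow_left₀ (sqrtModulus_pos (by positivity)).le
    (h (1 / 2 ^ n) (by positivity)) (2 ^ n)
  simp only [Function.comp_apply] at hn
  linarith

lemma continuousOn_sqrtModulus : ContinuousOn sqrtModulus (Set.Ioi 0) :=
  (continuousOn_realTheta_zero (1 / 2)).div (continuousOn_realTheta_zero 0)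
    fun _ hy => (realTheta3_zero_pos hy).ne'

lemma exists_sqrtModulus_eq {c : ℝ} (hc0 : 0 < c) (hc : c < 1) : ∃ y > 0, sqrtModulus y = c := by
  obtain ⟨y, hy, h1⟩ := exists_lt_sqrtModulus hc0 hc
  obtain ⟨z, h2, hz⟩ := ((eventually_sqrtModulus_lt hc0).and (eventually_gt_atTop 0)).exists
  obtain ⟨w, hw, h⟩ := isPreconnected_Ioi.intermediate_value (s := Set.Ioi (0 : ℝ)) hz hy
    continuousOn_sqrtModulus ⟨h2.le, h1.le⟩
  exact ⟨w, hw, h⟩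

/-! ### The two quotients of theta functions -/

/-- This is strict monotonicity of `θ₂/θ₁`. After the product formula the two sides share one term,
and their other terms are opposite. -/
lemma realTheta2_mul_lt_mul {y x z : ℝ} (hy : 0 < y) (hz : 0 ≤ z) (hzx : z < x) (hx : x ≤ 1 / 2) :
    realTheta2 y x * realTheta2 y (1 / 2 - z) < realTheta2 y z * realTheta2 y (1 / 2 - x) := by
  have hy2 : 0 < 2 * y := by positivity
  rw [realTheta2_mul y hy, realTheta2_mul y hy,
    show x + (1 / 2 - z) = 1 / 2 + (x - z) by ring, show z + (1 / 2 - x) = 1 / 2 - (x - z) by ring,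
    show x - (1 / 2 - z) = x + z - 1 / 2 by ring, show z - (1 / 2 - x) = x + z - 1 / 2 by ring,
    realTheta2_half_add, realTheta3_half_add]
  rcases eq_or_lt_of_le (show x - z ≤ 1 / 2 by linarith) with h | h
  · rw [h, sub_self]
    nlinarith [mul_pos (realTheta2_zero_pos hy2) (realTheta3_pos hy2 (x + z - 1 / 2))]
  · have := realTheta2_pos hy2 (x := 1 / 2 - (x - z)) ⟨by linarith, by linarith⟩
    nlinarith [mul_pos this (realTheta3_pos hy2 (x + z - 1 / 2))]

/-- For fixed `y`, the quotient `θ₂ / θ₁` is injective on a quarter period. -/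
lemma eq_of_realTheta2_eq_mul {y a x z : ℝ} (hy : 0 < y) (hx : x ∈ Set.Ioo (0 : ℝ) (1 / 2))
    (hz : z ∈ Set.Ioo (0 : ℝ) (1 / 2)) (h1 : realTheta2 y x = a * realTheta2 y (1 / 2 - x))
    (h2 : realTheta2 y z = a * realTheta2 y (1 / 2 - z)) : x = z := by
  by_contra hne
  rcases lt_or_gt_of_ne hne with hlt | hlt
  · have := realTheta2_mul_lt_mul hy hx.1.le hlt hz.2.le
    rw [h1, h2] at this
    linarith
  · have := realTheta2_mul_lt_mul hy hz.1.le hlt hx.2.le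
    rw [h1, h2] at this
    linarith

lemma exists_realTheta2_eq_mul {y a : ℝ} (hy : 0 < y) (ha : 0 < a) :
    ∃ x ∈ Set.Ioo (0 : ℝ) (1 / 2), realTheta2 y x = a * realTheta2 y (1 / 2 - x) := by
  have hc := continuous_realTheta2 hy
  have h0 := realTheta2_zero_pos hy
  have hf : ContinuousOn (fun x => realTheta2 y x - a * realTheta2 y (1 / 2 - x))
      (Set.Icc 0 (1 / 2)) := by fun_prop
  obtain ⟨x, hx, h⟩ := intermediate_value_Ioo' (show (0 : ℝ) ≤ 1 / 2 by norm_num) hf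
    (show (0 : ℝ) ∈ _ by
      simp only [sub_self, sub_zero, realTheta2_half]
      constructor <;> nlinarith)
  exact ⟨x, hx, sub_eq_zero.mp h⟩

/-- The relation between the modulus and the two quotients of theta functions. -/
lemma sqrtModulus_pow_four_mul {y x a b : ℝ} (hy : 0 < y)
    (ha : realTheta2 y x = a * realTheta2 y (1 / 2 - x))
    (hb : realTheta3 y (1 / 4 + x) = b * realTheta3 y (1 / 4 - x)) :
    sqrtModulus (2 * y) ^ 4 *
      (1 - ((a ^ 2 - 1) / (a ^ 2 + 1)) ^ 2 * (1 - ((1 - b ^ 2) / (1 + b ^ 2)) ^ 2)) =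
      ((1 - b ^ 2) / (1 + b ^ 2)) ^ 2 ∧
    (1 - b ^ 2) / (1 + b ^ 2) * (realTheta3 (2 * y) (1 / 2 - 2 * x) * realTheta3 (2 * y) 0) =
      realTheta2 (2 * y) (1 / 2 - 2 * x) * realTheta2 (2 * y) 0 := by
  have hy2 : 0 < 2 * y := by positivity
  have ha2 := congrArg (· ^ 2) ha
  have hb2 := congrArg (· ^ 2) hb
  simp only [mul_pow] at ha2 hb2
  rw [realTheta2_sq hy, realTheta2_half_sub_sq hy] at ha2
  rw [realTheta3_sq hy, realTheta3_sq hy, show 2 * (1 / 4 + x) = 1 / 2 + 2 * x by ring,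
    show 2 * (1 / 4 - x) = 1 / 2 - 2 * x by ring, realTheta3_half_add, realTheta2_half_add] at hb2
  have r2 := realTheta2_sq_mul_sq hy2 (2 * x)
  have r3 := realTheta3_sq_mul_sq hy2 (2 * x)
  have hA := realTheta3_zero_pos hy2
  have hD := realTheta3_pos hy2 (1 / 2)
  have hU := realTheta3_pos hy2 (1 / 2 - 2 * x)
  rw [sqrtModulus]
  set A := realTheta3 (2 * y) 0
  set B := realTheta2 (2 * y) 0
  set D := realTheta3 (2 * y) (1 / 2)
  set P := realTheta2 (2 * y) (2 * x)
  set R := realTheta3 (2 * y) (2 * x)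
  set S := realTheta2 (2 * y) (1 / 2 - 2 * x)
  set U := realTheta3 (2 * y) (1 / 2 - 2 * x)
  obtain ⟨p, hp⟩ : ∃ p, p = (a ^ 2 - 1) / (a ^ 2 + 1) := ⟨_, rfl⟩
  obtain ⟨q, hq⟩ : ∃ q, q = (1 - b ^ 2) / (1 + b ^ 2) := ⟨_, rfl⟩
  rw [← hp, ← hq]
  -- The squared equations are linear in values at `2y`; `p` and `q` are the resulting ratios
  -- `PA/(RB)` and `SB/(UA)`.
  have ep : p * (R * B) = P * A := by
    rw [hp]
    field_simp
    linear_combination -ha2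
  have eq : q * (U * A) = S * B := by
    rw [hq]
    field_simp
    linear_combination hb2
  refine ⟨?_, eq⟩
  -- The identities for `θ₂²` and `θ₃²` eliminate `P` and `R`; next, `S B = q U A` eliminates `S`,
  -- leaving the nonzero factor `A² U²`.
  have e1 : A ^ 2 * (U ^ 2 * B ^ 2 - S ^ 2 * A ^ 2) =
      p ^ 2 * B ^ 2 * (U ^ 2 * A ^ 2 - S ^ 2 * B ^ 2) := by
    rw [← r2, ← r3]
    linear_combination -(P * A + p * (R * B)) * D ^ 2 * ep
  have e2 : A ^ 2 * U ^ 2 * (B ^ 4 * (1 - p ^ 2 * (1 - q ^ 2)) - q ^ 2 * A ^ 4) = 0 := by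
    linear_combination B ^ 2 * e1 - (A ^ 4 - p ^ 2 * B ^ 4) * (q * U * A + S * B) * eq
  have e3 := (mul_eq_zero.mp e2).resolve_left (by positivity)
  rw [div_pow]
  field_simp
  linear_combination e3

/-! ### Jacobi theta functions and the prime form -/

lemma theta3_pi_mul {y : ℝ} (hy : 0 < y) (x : ℝ) :
    theta3 (Real.pi * x) (y * Complex.I) = (realTheta3 y x : ℂ) := by
  have hpi : (Real.pi : ℂ) ≠ 0 := Complex.ofReal_ne_zero.mpr Real.pi_ne_zero
  rw [realTheta3, ← tsum_thetaTerm (k := 0) (by simp) hy, theta3, jacobiTheta₂,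
    mul_div_cancel_left₀ _ hpi]
  refine tsum_congr fun n => ?_
  rw [jacobiTheta₂_term, thetaTerm]
  congr 1
  push_cast
  linear_combination (Real.pi * n ^ 2 * y : ℂ) * Complex.I_mul_I

lemma theta1_pi_mul {y : ℝ} (hy : 0 < y) (x : ℝ) :
    theta1 (Real.pi * x) (y * Complex.I) = -(realTheta2 y (x + 1 / 2) : ℂ) := by
  have hpi : (Real.pi : ℂ) ≠ 0 := Complex.ofReal_ne_zero.mpr Real.pi_ne_zero
  rw [realTheta2, ← tsum_thetaTerm (k := 1) (by norm_num) hy, theta1, thetaChar,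
    mul_div_cancel_left₀ _ hpi]
  congr 1
  refine tsum_congr fun n => ?_
  rw [thetaTerm]
  congr 1
  push_cast
  linear_combination (Real.pi * (n + 1 / 2) ^ 2 * y : ℂ) * Complex.I_mul_I

lemma theta1_eq_exp_mul (z τ : ℂ) :
    theta1 z τ = -(Complex.exp (Real.pi * Complex.I * (τ / 4 + z / Real.pi + 1 / 2)) *
      jacobiTheta₂ (z / Real.pi + 1 / 2 + τ / 2) τ) := by
  rw [theta1, thetaChar, jacobiTheta₂, ← tsum_mul_left]
  congr 1
  refine tsum_congr fun n => ?_
  rw [jacobiTheta₂_term, ← Complex.exp_add]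
  congr 1
  push_cast
  ring

lemma differentiableAt_theta1 (z : ℂ) {τ : ℂ} (hτ : 0 < τ.im) :
    DifferentiableAt ℂ (fun z => theta1 z τ) z := by
  simp only [theta1_eq_exp_mul]
  have h := (differentiableAt_jacobiTheta₂_fst (z / Real.pi + 1 / 2 + τ / 2) hτ).comp z
    (f := fun z : ℂ => z / Real.pi + 1 / 2 + τ / 2) (by fun_prop)
  exact ((by fun_prop : DifferentiableAt ℂ (fun z : ℂ =>
    Complex.exp (Real.pi * Complex.I * (τ / 4 + z / Real.pi + 1 / 2))) z).mul h).neg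

/-- The prime form divides by this derivative; were it zero, all weights would be `0`. A zero
derivative would give `θ₁(u) = o(u)`, against the lower bound of `θ₂` by the cosine. -/
lemma deriv_theta1_zero_ne_zero {y : ℝ} (hy : 0 < y) :
    deriv (fun z => theta1 z (y * Complex.I)) 0 ≠ 0 := by
  intro h0
  obtain ⟨c, hc, hle⟩ := exists_mul_abs_cos_le_abs_realTheta2 hy
  have hd := (differentiableAt_theta1 0 (τ := y * Complex.I) (by simpa using hy)).hasDerivAt
  rw [h0] at hd
  have hz : theta1 0 (y * Complex.I) = 0 := by
    have := theta1_pi_mul hy 0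
    rw [Complex.ofReal_zero, mul_zero, zero_add, realTheta2_half] at this
    simpa using this
  have ho := hd.isLittleO
  simp only [hz, sub_zero, smul_zero] at ho
  -- Jordan's inequality gives the lower bound `(2c/π) u`; half of that slope is enough for a
  -- contradiction.
  have hev := ho.def (show 0 < c / Real.pi by positivity)
  obtain ⟨ε, hε, hb⟩ := Metric.eventually_nhds_iff.mp hev
  set u := min (ε / 2) 1
  have hu : 0 < u := by positivity
  have hu1 : u ≤ Real.pi / 2 := (min_le_right _ _).trans (by linarith [Real.pi_gt_three])
  have hb' := hb (y := (u : ℂ)) (by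
    rw [dist_zero_right, Complex.norm_real, Real.norm_of_nonneg hu.le]
    exact (min_le_left _ _).trans_lt (half_lt_self hε))
  have e : (u : ℂ) = Real.pi * ((u / Real.pi : ℝ) : ℂ) := by
    rw [← Complex.ofReal_mul, mul_div_cancel₀ _ Real.pi_ne_zero]
  have h1 := hle (u / Real.pi + 1 / 2)
  rw [show Real.pi * (u / Real.pi + 1 / 2) = u + Real.pi / 2 by field_simp,
    Real.cos_add_pi_div_two, abs_neg] at h1
  have h2 : ‖theta1 u (y * Complex.I)‖ = |realTheta2 y (u / Real.pi + 1 / 2)| := by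
    rw [e, theta1_pi_mul hy, norm_neg, Complex.norm_real, Real.norm_eq_abs]
  rw [h2, Complex.norm_real, Real.norm_of_nonneg hu.le] at hb'
  have h3 := Real.mul_le_sin hu.le hu1
  have h4 := le_abs_self (Real.sin u)
  have h5 : c * (2 / Real.pi * u) ≤ c / Real.pi * u :=
    (mul_le_mul_of_nonneg_left (h3.trans h4) hc.le).trans (h1.trans hb')
  have h6 : c * (2 / Real.pi * u) = 2 * (c / Real.pi * u) := by ring
  have h7 : 0 < c / Real.pi * u := by positivity
  linarith

/-- The normalization `π |θ₁'(0)|` of the prime form. -/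
def primeFormNorm (y : ℝ) : ℝ := Real.pi * ‖deriv (fun z => theta1 z (y * Complex.I)) 0‖

lemma primeFormNorm_pos {y : ℝ} (hy : 0 < y) : 0 < primeFormNorm y :=
  mul_pos Real.pi_pos (norm_pos_iff.mpr (deriv_theta1_zero_ne_zero hy))

lemma norm_primeForm {y : ℝ} (hy : 0 < y) (u v : ℝ) :
    ‖primeForm (y * Complex.I) u v‖ = |realTheta2 y (v - u + 1 / 2)| / primeFormNorm y := by
  rw [primeForm, ← Complex.ofReal_sub, theta1_pi_mul hy, norm_div, norm_neg, norm_mul,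
    Complex.norm_real, Complex.norm_real, Real.norm_eq_abs, Real.norm_of_nonneg Real.pi_pos.le,
    primeFormNorm]

lemma abs_realTheta2_add_intCast (y x : ℝ) (m : ℤ) :
    |realTheta2 y (x + m)| = |realTheta2 y x| := by
  have h : Function.Periodic (fun x => |realTheta2 y x|) 1 := fun x => by
    simp only [realTheta2_add_one, abs_neg]
  simpa using h.int_mul m x

lemma realTheta3_add_intCast (y x : ℝ) (m : ℤ) : realTheta3 y (x + m) = realTheta3 y x := by
  simpa using Function.Periodic.int_mul (f := realTheta3 y) (realTheta3_add_one y) m x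

/-- Here `t = 1/4` matters: `3/4 + x` is `-(1/4 - x)` modulo `1`, and `θ₃` is even, so half-integer
shifts produce only two values. -/
lemma realTheta3_quarter_add_half (y x : ℝ) (m : ℤ) :
    realTheta3 y (1 / 4 + (x + m / 2)) =
      if Even m then realTheta3 y (1 / 4 + x) else realTheta3 y (1 / 4 - x) := by
  rcases Int.even_or_odd' m with ⟨k, rfl | rfl⟩
  · rw [if_pos (even_two_mul k), ← realTheta3_add_intCast y (1 / 4 + x) k]
    push_cast
    ring_nf
  · rw [if_neg (Int.not_even_two_mul_add_one k), ← realTheta3_neg y (1 / 4 - x),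
      ← realTheta3_add_intCast y (-(1 / 4 - x)) (k + 1)]
    push_cast
    ring_nf

/-! ### Fock's weights for the four angles -/

/-- Lifts of angles that are compatible with the conditions on the angles modulo `1`. -/
structure LiftedAngles (ρ α β γ δ : ℝ) (k l m : ℤ) : Prop where
  beta : β = α + 1 / 2 + k
  delta : δ = γ + 1 / 2 + l
  gamma : γ = α + ρ + m

lemma exists_intCast_of_coe_sub_coe {x y z : ℝ}
    (h : (x : UnitAddCircle) - (y : UnitAddCircle) = (z : UnitAddCircle)) :
    ∃ m : ℤ, x = y + z + m := by
  rw [← AddCircle.coe_sub, ← sub_eq_zero, ← AddCircle.coe_sub, AddCircle.coe_eq_zero_iff] at h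
  obtain ⟨m, hm⟩ := h
  rw [zsmul_one] at hm
  exact ⟨m, by linarith⟩

lemma BiasedAngles.exists_lifted {ρ α β γ δ : ℝ} (h : BiasedAngles ρ α β γ δ) :
    ∃ k l m, LiftedAngles ρ α β γ δ k l m := by
  obtain ⟨-, h1, h2, h3, -⟩ := h
  obtain ⟨k, hk⟩ := exists_intCast_of_coe_sub_coe h1
  obtain ⟨l, hl⟩ := exists_intCast_of_coe_sub_coe h2
  obtain ⟨m, hm⟩ := exists_intCast_of_coe_sub_coe h3
  exact ⟨k, l, m, ⟨hk, hl, hm⟩⟩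

section Periodic

variable {ρ α β γ δ : ℝ} {k l m : ℤ}

lemma norm_primeForm_angles (h : LiftedAngles ρ α β γ δ k l m) {y : ℝ} (hy : 0 < y) (c r : ℕ) :
    ‖if Even (c + r) then
        primeForm (y * Complex.I) (rowAngle (fun _ => α) (fun _ => β) r)
          (colAngle (fun _ => γ) (fun _ => δ) c)
      else
        primeForm (y * Complex.I) (colAngle (fun _ => γ) (fun _ => δ) c)
          (rowAngle (fun _ => α) (fun _ => β) r)‖ =
      |if Even (c + r) then realTheta2 y (1 / 2 - ρ) else realTheta2 y ρ| / primeFormNorm y := by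
  obtain ⟨hβ, hδ, hγ⟩ := h
  have key : ∀ x z : ℝ, ∀ n : ℤ, x = z + n → |realTheta2 y x| = |realTheta2 y z| := by
    rintro x z n rfl
    exact abs_realTheta2_add_intCast y z n
  have key' : ∀ x z : ℝ, ∀ n : ℤ, x = -z + n → |realTheta2 y x| = |realTheta2 y z| := by
    intro x z n hx
    rw [key x (-z) n hx, realTheta2_neg]
  rcases Nat.even_or_odd c with hc | hc <;> rcases Nat.even_or_odd r with hr | hr
  · rw [if_pos (hc.add hr), if_pos (hc.add hr), norm_primeForm hy, rowAngle, colAngle, if_pos hc,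
      if_pos hr, key' _ (1 / 2 - ρ) (1 + m)]
    rw [hγ]; push_cast; ring
  · have hn := Nat.not_even_iff_odd.mpr (hc.add_odd hr)
    rw [if_neg hn, if_neg hn, norm_primeForm hy, rowAngle, colAngle, if_pos hc,
      if_neg (Nat.not_even_iff_odd.mpr hr), key' _ ρ (1 + k - m)]
    rw [hγ, hβ]; push_cast; ring
  · have hn := Nat.not_even_iff_odd.mpr (hc.add_even hr)
    rw [if_neg hn, if_neg hn, norm_primeForm hy, rowAngle, colAngle, if_pos hr,
      if_neg (Nat.not_even_iff_odd.mpr hc), key' _ ρ (- l - m)]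
    rw [hδ, hγ]; push_cast; ring
  · rw [if_pos (hc.add_odd hr), if_pos (hc.add_odd hr), norm_primeForm hy, rowAngle, colAngle,
      if_neg (Nat.not_even_iff_odd.mpr hc), if_neg (Nat.not_even_iff_odd.mpr hr),
      key' _ (1 / 2 - ρ) (1 + l + m - k)]
    rw [hδ, hβ, hγ]; push_cast; ring

lemma sum_colAngle_even (γ δ : ℝ) (n : ℕ) :
    ∑ i ∈ Finset.range (2 * n), (-1) ^ i * colAngle (fun _ => γ) (fun _ => δ) i = n * (γ - δ) := by
  induction n with
  | zero => simp
  | succ n ih =>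
    rw [Nat.mul_succ, Finset.sum_range_succ, Finset.sum_range_succ, ih, colAngle, colAngle,
      if_pos (even_two_mul n), if_neg (Nat.not_even_two_mul_add_one n), pow_succ, pow_mul]
    norm_num
    ring

lemma sum_rowAngle_even (α β : ℝ) (n : ℕ) :
    ∑ j ∈ Finset.range (2 * n), (-1) ^ (j + 1) * rowAngle (fun _ => α) (fun _ => β) j =
      n * (β - α) := by
  induction n with
  | zero => simp
  | succ n ih =>
    rw [Nat.mul_succ, Finset.sum_range_succ, Finset.sum_range_succ, ih, rowAngle, rowAngle,
      if_pos (even_two_mul n), if_neg (Nat.not_even_two_mul_add_one n), pow_succ, pow_succ, pow_succ,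
      (even_two_mul n).neg_one_pow]
    push_cast
    ring

lemma abelMap_even_even (α β γ δ : ℝ) (i j : ℕ) :
    abelMap (fun _ => α) (fun _ => β) (fun _ => γ) (fun _ => δ) (2 * i, 2 * j) =
      i * (γ - δ) + j * (β - α) := by
  rw [abelMap, sum_colAngle_even, sum_rowAngle_even]

lemma abelMap_odd_odd (α β γ δ : ℝ) (i j : ℕ) :
    abelMap (fun _ => α) (fun _ => β) (fun _ => γ) (fun _ => δ) (2 * i + 1, 2 * j + 1) =
      i * (γ - δ) + j * (β - α) + (γ - α) := by
  rw [abelMap]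
  dsimp only
  rw [Finset.sum_range_succ, Finset.sum_range_succ, sum_colAngle_even, sum_rowAngle_even, colAngle,
    rowAngle, if_pos (even_two_mul i), if_pos (even_two_mul j), pow_succ, pow_mul, pow_mul]
  norm_num
  ring

/-- The Abel map is in `½ℤ` at faces with even coordinates, where `θ₃` is then always `θ₃(1/4)`. At
faces with odd coordinates it is in `ρ + ½ℤ`, and the parity of `p + j` selects the sign of `ρ`. -/
lemma fockWeight_eq (h : LiftedAngles ρ α β γ δ k l m) {y : ℝ} (hy : 0 < y) (i j p q : ℕ) :
    fockWeight (y * Complex.I) (1 / 4) (fun _ => α) (fun _ => β) (fun _ => γ) (fun _ => δ)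
        (2 * i, 2 * j + 1) (2 * p + 1, 2 * q) =
      |if Even (edgeCol (2 * i, 2 * j + 1) (2 * p + 1, 2 * q) +
          edgeRow (2 * i, 2 * j + 1) (2 * p + 1, 2 * q)) then realTheta2 y (1 / 2 - ρ)
        else realTheta2 y ρ| / primeFormNorm y /
      (realTheta3 y (1 / 4) *
        if Even (p + j) then realTheta3 y (1 / 4 + ρ) else realTheta3 y (1 / 4 - ρ)) := by
  have e0 : realTheta3 y (1 / 4 + abelMap (fun _ => α) (fun _ => β) (fun _ => γ) (fun _ => δ)
      (2 * i, 2 * q)) = realTheta3 y (1 / 4) := by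
    have := realTheta3_quarter_add_half y 0 (q * (1 + 2 * k) - i * (1 + 2 * l))
    rw [add_zero, sub_zero, ite_self] at this
    rw [← this, abelMap_even_even, h.beta, h.delta]
    push_cast
    ring_nf
  have e1 : realTheta3 y (1 / 4 + abelMap (fun _ => α) (fun _ => β) (fun _ => γ) (fun _ => δ)
      (2 * p + 1, 2 * j + 1)) =
      if Even (p + j) then realTheta3 y (1 / 4 + ρ) else realTheta3 y (1 / 4 - ρ) := by
    have := realTheta3_quarter_add_half y ρ (j * (1 + 2 * k) - p * (1 + 2 * l) + 2 * m)
    have hpar : Even ((j : ℤ) * (1 + 2 * k) - p * (1 + 2 * l) + 2 * m) ↔ Even (p + j) := by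
      rw [← Int.even_coe_nat (p + j)]
      simp only [Int.even_add, Int.even_sub, Int.even_mul, Nat.cast_add, Int.not_even_one,
        even_two, true_or, iff_true, or_false]
      tauto
    simp only [hpar] at this
    rw [← this, abelMap_odd_odd, h.beta, h.delta, h.gamma]
    push_cast
    ring_nf
  rw [fockWeight, fockKasteleyn, norm_div, norm_primeForm_angles h hy, ← Complex.ofReal_add,
    ← Complex.ofReal_add, theta3_pi_mul hy, theta3_pi_mul hy, e0, e1, norm_mul, Complex.norm_real,
    Complex.norm_real, Real.norm_of_nonneg (realTheta3_pos hy _).le, Real.norm_of_nonneg]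
  split_ifs <;> exact (realTheta3_pos hy _).le

end Periodic

/-! ### The biased weights and gauge equivalence -/

/-- The three factors depend respectively on the parity of column plus row, on the adjacent face
with odd coordinates, and on the white vertex; a gauge function absorbs the last. -/
lemma biasedMatrix_apply (a : ℝ) {b : ℝ} (hb : b ≠ 0) (r c : Fin 4) :
    !![1 / b, a, b, a;
       a / b, 1, a * b, 1;
       b, a, 1 / b, a;
       a * b, 1, a / b, 1] r c =
      (if Even ((c : ℕ) + r) then 1 else a) *
        ((if Even ((c : ℕ) / 2 + (r : ℕ) / 2) then 1 / b else 1) *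
          (if Even (((c : ℕ) + 1) / 2 + (r : ℕ) / 2) then 1 else b)) := by
  fin_cases r <;> fin_cases c <;> simp [hb, Nat.even_iff, div_eq_mul_inv]

lemma biasedWeight_eq (a : ℝ) {b : ℝ} (hb : b ≠ 0) {i j p q : ℕ} (hip : i = p ∨ i = p + 1)
    (hjq : j = q ∨ q = j + 1) :
    biasedWeight a b (2 * i, 2 * j + 1) (2 * p + 1, 2 * q) =
      (if Even (edgeCol (2 * i, 2 * j + 1) (2 * p + 1, 2 * q) +
          edgeRow (2 * i, 2 * j + 1) (2 * p + 1, 2 * q)) then 1 else a) *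
        ((if Even (p + j) then 1 / b else 1) * (if Even (i + j) then 1 else b)) := by
  have hc : edgeCol (2 * i, 2 * j + 1) (2 * p + 1, 2 * q) = min (2 * i) (2 * p + 1) := rfl
  have hr : edgeRow (2 * i, 2 * j + 1) (2 * p + 1, 2 * q) = min (2 * j + 1) (2 * q) := rfl
  rw [biasedWeight, biasedMatrix_apply a hb, hc, hr]
  have e1 : Even (min (2 * i) (2 * p + 1) % 4 + min (2 * j + 1) (2 * q) % 4) ↔
      Even (min (2 * i) (2 * p + 1) + min (2 * j + 1) (2 * q)) := by
    rw [Nat.even_iff, Nat.even_iff]; omega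
  have e2 : Even (min (2 * i) (2 * p + 1) % 4 / 2 + min (2 * j + 1) (2 * q) % 4 / 2) ↔
      Even (p + j) := by
    rw [Nat.even_iff, Nat.even_iff]; omega
  have e3 : Even ((min (2 * i) (2 * p + 1) % 4 + 1) / 2 + min (2 * j + 1) (2 * q) % 4 / 2) ↔
      Even (i + j) := by
    rw [Nat.even_iff, Nat.even_iff]; omega
  simp only [Fin.val_ofNat, e1, e2, e3]

lemma IsEdge.exists_coords {n : ℕ} {w b : ℕ × ℕ} (h : IsEdge n w b) :
    ∃ i j p q, w = (2 * i, 2 * j + 1) ∧ b = (2 * p + 1, 2 * q) ∧ (i = p ∨ i = p + 1) ∧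
      (j = q ∨ q = j + 1) := by
  obtain ⟨w1, w2⟩ := w
  obtain ⟨b1, b2⟩ := b
  obtain ⟨⟨hw1, -, hw2, -⟩, ⟨hb1, -, hb2, -⟩, h1, h2⟩ := h
  dsimp only at *
  obtain ⟨i, rfl⟩ := hw1.two_dvd
  obtain ⟨j, rfl⟩ := hw2
  obtain ⟨p, rfl⟩ := hb1
  obtain ⟨q, rfl⟩ := hb2.two_dvd
  exact ⟨i, j, p, q, rfl, rfl, by omega, by omega⟩

lemma isEdge_of_coords {n i j p q : ℕ} (hi : i ≤ n) (hj : j < n) (hp : p < n) (hq : q ≤ n)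
    (hip : i = p ∨ i = p + 1) (hjq : j = q ∨ q = j + 1) :
    IsEdge n (2 * i, 2 * j + 1) (2 * p + 1, 2 * q) := by
  refine ⟨⟨even_two_mul i, ?_, odd_two_mul_add_one j, ?_⟩,
    ⟨odd_two_mul_add_one p, ?_, even_two_mul q, ?_⟩, ?_, ?_⟩ <;> dsimp only <;> omega

/-- Sufficiency of the two equations for the gauge equivalence of Fock's weights and the biased
weights. -/
lemma gaugeEquivalent_of_eq {a b ρ α β γ δ y : ℝ} {k l m : ℤ} (hb : 0 < b)
    (hρ : 0 < ρ) (hρ' : ρ < 1 / 2) (h : LiftedAngles ρ α β γ δ k l m) (hy : 0 < y)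
    (e2 : realTheta2 y ρ = a * realTheta2 y (1 / 2 - ρ))
    (e3 : realTheta3 y (1 / 4 + ρ) = b * realTheta3 y (1 / 4 - ρ)) (n : ℕ) :
    GaugeEquivalent n
      (fockWeight (y * Complex.I) (1 / 4) (fun _ => α) (fun _ => β) (fun _ => γ) (fun _ => δ))
      (biasedWeight a b) := by
  have hs := realTheta2_pos hy (x := 1 / 2 - ρ) ⟨by linarith, by linarith⟩
  have hc := realTheta2_pos hy (x := ρ) ⟨by linarith, hρ'⟩
  have hB := realTheta3_pos hy (1 / 4 - ρ)
  have hT := realTheta3_pos hy (1 / 4)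
  have hE := primeFormNorm_pos hy
  -- White vertices are those with even first coordinate, and halving recovers `i + j`. The gauge is
  -- `1` on black vertices.
  refine ⟨fun v => if Even v.1 then primeFormNorm y * realTheta3 y (1 / 4) *
    realTheta3 y (1 / 4 - ρ) / realTheta2 y (1 / 2 - ρ) *
      (if Even (v.1 / 2 + v.2 / 2) then 1 else b) else 1, fun w v hwv => ?_⟩
  obtain ⟨i, j, p, q, rfl, rfl, hip, hjq⟩ := hwv.exists_coords
  rw [fockWeight_eq h hy, biasedWeight_eq a hb.ne' hip hjq]
  have e4 : 2 * i / 2 + (2 * j + 1) / 2 = i + j := by omega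
  simp only [even_two_mul, if_true, Nat.not_even_two_mul_add_one, if_false, e4, mul_one]
  have e5 : ∀ P : Prop, ∀ _ : Decidable P,
      |if P then realTheta2 y (1 / 2 - ρ) else realTheta2 y ρ| =
        (if P then 1 else a) * realTheta2 y (1 / 2 - ρ) := by
    intro P _
    split_ifs
    · rw [abs_of_pos hs, one_mul]
    · rw [abs_of_pos hc, e2]
  have e6 : ∀ P : Prop, ∀ _ : Decidable P,
      (if P then realTheta3 y (1 / 4 + ρ) else realTheta3 y (1 / 4 - ρ)) =
        realTheta3 y (1 / 4 - ρ) / (if P then 1 / b else 1) := by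
    intro P _
    split_ifs
    · rw [e3]; field_simp
    · rw [div_one]
  rw [e5, e6]
  have e7 : (if Even (p + j) then 1 / b else 1) ≠ 0 := by
    split_ifs <;> positivity
  generalize (if Even (p + j) then 1 / b else 1) = u at e7 ⊢
  generalize realTheta2 y (1 / 2 - ρ) = s at hs ⊢
  generalize realTheta3 y (1 / 4 - ρ) = B at hB ⊢
  generalize realTheta3 y (1 / 4) = T at hT ⊢
  field_simp

/-- Each vertex of the face occurs once on either side of the alternating product, so `ψ` cancels.
-/
lemma GaugeEquivalent.face {n : ℕ} {ν ν' : ℕ × ℕ → ℕ × ℕ → ℝ} (h : GaugeEquivalent n ν ν')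
    {w₁ w₂ b₁ b₂ : ℕ × ℕ} (h₁₁ : IsEdge n w₁ b₁) (h₁₂ : IsEdge n w₁ b₂) (h₂₁ : IsEdge n w₂ b₁)
    (h₂₂ : IsEdge n w₂ b₂) :
    ν' w₁ b₁ * ν' w₂ b₂ * (ν w₁ b₂ * ν w₂ b₁) = ν' w₁ b₂ * ν' w₂ b₁ * (ν w₁ b₁ * ν w₂ b₂) := by
  obtain ⟨ψ, hψ⟩ := h
  rw [hψ _ _ h₁₁, hψ _ _ h₁₂, hψ _ _ h₂₁, hψ _ _ h₂₂]
  ring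

/-- Necessity of the two equations for the gauge equivalence of Fock's weights and the biased
weights. -/
lemma eq_of_gaugeEquivalent {a b ρ α β γ δ y : ℝ} {k l m : ℤ} (ha : 0 < a) (hb : 0 < b)
    (hρ : 0 < ρ) (hρ' : ρ < 1 / 2) (h : LiftedAngles ρ α β γ δ k l m) (hy : 0 < y) {n : ℕ}
    (hn : 2 ≤ n)
    (hg : GaugeEquivalent n
      (fockWeight (y * Complex.I) (1 / 4) (fun _ => α) (fun _ => β) (fun _ => γ) (fun _ => δ))
      (biasedWeight a b)) :
    realTheta2 y ρ = a * realTheta2 y (1 / 2 - ρ) ∧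
      realTheta3 y (1 / 4 + ρ) = b * realTheta3 y (1 / 4 - ρ) := by
  have hs := realTheta2_pos hy (x := 1 / 2 - ρ) ⟨by linarith, by linarith⟩
  have hc := realTheta2_pos hy (x := ρ) ⟨by linarith, hρ'⟩
  have hA := realTheta3_pos hy (1 / 4 + ρ)
  have hB := realTheta3_pos hy (1 / 4 - ρ)
  have hT := realTheta3_pos hy (1 / 4)
  have hE := primeFormNorm_pos hy
  have edge : ∀ i j p q : ℕ, i ≤ n → j < n → p < n → q ≤ n → (i = p ∨ i = p + 1) →
      (j = q ∨ q = j + 1) → IsEdge n (2 * i, 2 * j + 1) (2 * p + 1, 2 * q) :=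
    fun i j p q => isEdge_of_coords
  -- Around `(1, 1)` all edges share that odd face, so the `θ₃` factors cancel and only the equation
  -- for `a` is left.
  have f1 := hg.face (edge 0 0 0 0 (by omega) (by omega) (by omega) (by omega) (by omega) (by omega))
    (edge 0 0 0 1 (by omega) (by omega) (by omega) (by omega) (by omega) (by omega))
    (edge 1 0 0 0 (by omega) (by omega) (by omega) (by omega) (by omega) (by omega))
    (edge 1 0 0 1 (by omega) (by omega) (by omega) (by omega) (by omega) (by omega))
  -- Around `(2, 2)`, which is interior only for `n ≥ 2`, the odd faces alternate between `1/4 + ρ`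
  -- and `1/4 - ρ`; this detects `b`.
  have f2 := hg.face (edge 1 0 0 1 (by omega) (by omega) (by omega) (by omega) (by omega) (by omega))
    (edge 1 0 1 1 (by omega) (by omega) (by omega) (by omega) (by omega) (by omega))
    (edge 1 1 0 1 (by omega) (by omega) (by omega) (by omega) (by omega) (by omega))
    (edge 1 1 1 1 (by omega) (by omega) (by omega) (by omega) (by omega) (by omega))
  rw [fockWeight_eq h hy, fockWeight_eq h hy, fockWeight_eq h hy, fockWeight_eq h hy,
    biasedWeight_eq a hb.ne' (by omega) (by omega), biasedWeight_eq a hb.ne' (by omega) (by omega),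
    biasedWeight_eq a hb.ne' (by omega) (by omega), biasedWeight_eq a hb.ne' (by omega) (by omega)]
    at f1 f2
  generalize realTheta2 y (1 / 2 - ρ) = s at *
  generalize realTheta2 y ρ = c at *
  generalize realTheta3 y (1 / 4 + ρ) = A at *
  generalize realTheta3 y (1 / 4 - ρ) = B at *
  generalize realTheta3 y (1 / 4) = T at *
  generalize primeFormNorm y = E at *
  simp only [edgeCol, edgeRow, Nat.even_iff] at f1 f2
  norm_num [abs_of_pos hs, abs_of_pos hc] at f1 f2
  field_simp at f1 f2
  have hsc : c = a * s := (sq_eq_sq₀ hc.le (by positivity)).mp (by rw [f1]; ring)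
  refine ⟨hsc, (sq_eq_sq₀ hA.le (by positivity)).mp ?_⟩
  rw [hsc] at f2
  refine mul_left_cancel₀ (show (a * s) ^ 2 ≠ 0 by positivity) ?_
  rw [f2]
  ring

/-! ### Solving the two equations -/

/-- With `p = (a² - 1)/(a² + 1)`, the difference of the two sides is `(1 - p²)(1 - q²)`. Hence the
prescribed squared modulus is less than `1`. -/
lemma modulusDenominator_pos {a q : ℝ} (ha : 0 < a) (hq0 : 0 < q) (hq1 : q < 1) :
    q ^ 2 < 1 - ((a ^ 2 - 1) / (a ^ 2 + 1)) ^ 2 * (1 - q ^ 2) := by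
  have h1 : ((a ^ 2 - 1) / (a ^ 2 + 1)) ^ 2 < 1 := by
    rw [div_pow, div_lt_one (by positivity)]
    nlinarith [pow_pos ha 2]
  have h2 : 0 < 1 - q ^ 2 := by nlinarith
  nlinarith [mul_lt_mul_of_pos_right h1 h2]

/-- Two parameters with the same quotients of theta functions have the same modulus. -/
lemma eq_of_quotients_eq {a b y z x x' : ℝ} (ha : 0 < a) (hb0 : 0 < b) (hb1 : b < 1) (hy : 0 < y)
    (hz : 0 < z) (e2 : realTheta2 y x = a * realTheta2 y (1 / 2 - x))
    (e3 : realTheta3 y (1 / 4 + x) = b * realTheta3 y (1 / 4 - x))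
    (e2' : realTheta2 z x' = a * realTheta2 z (1 / 2 - x'))
    (e3' : realTheta3 z (1 / 4 + x') = b * realTheta3 z (1 / 4 - x')) : z = y := by
  have hy2 : 0 < 2 * y := by positivity
  have hz2 : 0 < 2 * z := by positivity
  have h1 := (sqrtModulus_pow_four_mul hy e2 e3).1
  have h2 := (sqrtModulus_pow_four_mul hz e2' e3').1
  have hq0 : 0 < (1 - b ^ 2) / (1 + b ^ 2) := div_pos (by nlinarith) (by positivity)
  have hq1 : (1 - b ^ 2) / (1 + b ^ 2) < 1 := by
    rw [div_lt_one (by positivity)]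
    nlinarith [pow_pos hb0 2]
  have hd := (pow_pos hq0 2).trans (modulusDenominator_pos ha hq0 hq1)
  have h3 := mul_right_cancel₀ hd.ne' (h2.trans h1.symm)
  have h4 := (pow_left_inj₀ (sqrtModulus_pos hz2).le (sqrtModulus_pos hy2).le four_ne_zero).mp h3
  have h5 : 2 * z = 2 * y := sqrtModulus_injOn hz2 hy2 h4
  linarith

/-- Existence of a parameter with given quotients of theta functions. -/
lemma exists_quotients_eq {a b : ℝ} (ha : 0 < a) (hb0 : 0 < b) (hb1 : b < 1) :
    ∃ y > 0, ∃ x ∈ Set.Ioo (0 : ℝ) (1 / 2),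
      realTheta2 y x = a * realTheta2 y (1 / 2 - x) ∧
      realTheta3 y (1 / 4 + x) = b * realTheta3 y (1 / 4 - x) := by
  obtain ⟨q, hq⟩ : ∃ q, q = (1 - b ^ 2) / (1 + b ^ 2) := ⟨_, rfl⟩
  have hq0 : 0 < q := by rw [hq]; exact div_pos (by nlinarith) (by positivity)
  have hq1 : q < 1 := by
    rw [hq, div_lt_one (by positivity)]
    nlinarith [pow_pos hb0 2]
  have hd := modulusDenominator_pos ha hq0 hq1
  obtain ⟨p, hp⟩ : ∃ p, p = (a ^ 2 - 1) / (a ^ 2 + 1) := ⟨_, rfl⟩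
  have hp1 : p ^ 2 < 1 := by
    rw [hp, div_pow, div_lt_one (by positivity)]
    nlinarith [pow_pos ha 2]
  rw [← hp] at hd
  set d := 1 - p ^ 2 * (1 - q ^ 2) with hdef
  have hd0 : 0 < d := (pow_pos hq0 2).trans hd
  have hκ0 : 0 < q ^ 2 / d := by positivity
  have hκ1 : q ^ 2 / d < 1 := by rwa [div_lt_one hd0]
  obtain ⟨Y, hY, hYk⟩ := exists_sqrtModulus_eq (c := Real.sqrt (Real.sqrt (q ^ 2 / d)))
    (by positivity) (by
      rw [Real.sqrt_lt' one_pos, one_pow, Real.sqrt_lt' one_pos, one_pow]; exact hκ1)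
  have hY4 : sqrtModulus Y ^ 4 = q ^ 2 / d := by
    rw [hYk, show 4 = 2 * 2 by norm_num, pow_mul, Real.sq_sqrt (by positivity),
      Real.sq_sqrt (by positivity)]
  have hy : 0 < Y / 2 := half_pos hY
  obtain ⟨x, hx, e2⟩ := exists_realTheta2_eq_mul hy ha
  refine ⟨Y / 2, hy, x, hx, e2, ?_⟩
  have hB := realTheta3_pos hy (1 / 4 - x)
  -- Only the modulus and the equation for `a` have been imposed; `b'` is the quotient that results,
  -- to be shown equal to `b`.
  obtain ⟨b', hb'⟩ : ∃ b', b' = realTheta3 (Y / 2) (1 / 4 + x) / realTheta3 (Y / 2) (1 / 4 - x) :=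
    ⟨_, rfl⟩
  have hb'0 : 0 < b' := by rw [hb']; exact div_pos (realTheta3_pos hy _) hB
  have e3 : realTheta3 (Y / 2) (1 / 4 + x) = b' * realTheta3 (Y / 2) (1 / 4 - x) := by
    rw [hb', div_mul_cancel₀ _ hB.ne']
  obtain ⟨h1, h2⟩ := sqrtModulus_pow_four_mul hy e2 e3
  rw [mul_div_cancel₀ Y two_ne_zero] at h1 h2
  obtain ⟨q', hq'⟩ : ∃ q', q' = (1 - b' ^ 2) / (1 + b' ^ 2) := ⟨_, rfl⟩
  rw [← hq', ← hp, hY4] at h1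
  rw [← hq'] at h2
  -- The modulus relation sees only `q'²`; the sign, from `θ₂ > 0` on `(-1/2, 1/2)`, excludes `q' =
  -- -q`.
  have hq'0 : 0 < q' := by
    refine pos_of_mul_pos_left (b := realTheta3 Y (1 / 2 - 2 * x) * realTheta3 Y 0) ?_
      (mul_pos (realTheta3_pos hY _) (realTheta3_pos hY _)).le
    rw [h2]
    exact mul_pos (realTheta2_pos hY ⟨by linarith [hx.2], by linarith [hx.1]⟩)
      (realTheta2_zero_pos hY)
  have h3 : q ^ 2 / d * d = q ^ 2 := div_mul_cancel₀ _ hd0.ne'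
  generalize q ^ 2 / d = κ at *
  -- Both `q²` and `q'²` solve `κ (1 - p²) = X (1 - κ p²)`, which is linear in `X`.
  have h4 : (q' ^ 2 - q ^ 2) * (1 - κ * p ^ 2) = 0 := by
    rw [hdef] at h3
    linear_combination h3 - h1
  have h5 : 1 - κ * p ^ 2 ≠ 0 := by nlinarith [sq_nonneg p]
  have h6 : q' = q :=
    (sq_eq_sq₀ hq'0.le hq0.le).mp (sub_eq_zero.mp ((mul_eq_zero.mp h4).resolve_right h5))
  have h7 : b' ^ 2 = b ^ 2 := by
    rw [hq, hq', div_eq_div_iff (by positivity) (by positivity)] at h6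
    linarith
  rw [e3, (sq_eq_sq₀ hb'0.le hb0.le).mp h7]

end

end AztecFock

open AztecFock
theorem proposition2p2 (a b : ℝ) (ha : 0 < a) (hb0 : 0 < b) (hb1 : b < 1) :
    ∃ (ρ : ℝ) (τ : ℂ), 0 < ρ ∧ ρ < 1 / 2 ∧ τ.re = 0 ∧ 0 < τ.im ∧
      (∀ n : ℕ, 1 ≤ n → ∀ α β γ δ : ℝ, BiasedAngles ρ α β γ δ →
        GaugeEquivalent n
          (fockWeight τ (1 / 4) (fun _ => α) (fun _ => β) (fun _ => γ) (fun _ => δ))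
          (biasedWeight a b)) ∧
      (∀ (ρ' : ℝ) (τ' : ℂ), 0 < ρ' → ρ' < 1 / 2 → τ'.re = 0 → 0 < τ'.im →
        ∀ n : ℕ, 2 ≤ n → ∀ α β γ δ : ℝ, BiasedAngles ρ' α β γ δ →
          GaugeEquivalent n
            (fockWeight τ' (1 / 4) (fun _ => α) (fun _ => β) (fun _ => γ) (fun _ => δ))
            (biasedWeight a b) →
          ρ' = ρ ∧ τ' = τ) := by
  obtain ⟨y, hy, ρ, hρ, e2, e3⟩ := exists_quotients_eq ha hb0 hb1
  refine ⟨ρ, y * Complex.I, hρ.1, hρ.2, by simp, by simpa using hy, ?_, ?_⟩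
  · intro n _ α β γ δ h
    obtain ⟨k, l, m, hl⟩ := h.exists_lifted
    exact gaugeEquivalent_of_eq hb0 hρ.1 hρ.2 hl hy e2 e3 n
  · intro ρ' τ' hρ0 hρ1 hre him n hn α β γ δ h hg
    obtain ⟨k, l, m, hl⟩ := h.exists_lifted
    obtain ⟨z, rfl⟩ : ∃ z : ℝ, τ' = z * Complex.I :=
      ⟨τ'.im, by apply Complex.ext <;> simp [hre]⟩
    replace him : 0 < z := by simpa using him
    obtain ⟨e2', e3'⟩ := eq_of_gaugeEquivalent ha hb0 hρ0 hρ1 hl him hn hg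
    obtain rfl := eq_of_quotients_eq ha hb0 hb1 hy him e2 e3 e2' e3'
    exact ⟨eq_of_realTheta2_eq_mul hy ⟨hρ0, hρ1⟩ hρ e2' e2, rfl⟩
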